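/- Fix an integer $d\ge 1$, a number $\gamma>0$ and Gaussian reference measures $\alpha=c_\alpha\mathcal N(m_\alpha,\Sigma_\alpha)$, $\beta=c_\beta\mathcal N(m_\beta,\Sigma_\beta)$ on $\mathbb R^d$ with $c_\alpha,c_\beta>0$ and $\Sigma_\alpha,\Sigma_\beta\succ O$. A plan is a finite measure $\pi$ on $\mathbb R^d\times\mathbb R^d$ with finite second moment; $\pi_1,\pi_2$ denote its marginals, and $$J(\pi)=\int\|x_2-x_1\|^2\,d\pi+\gamma\,\mathrm{KL}(\pi_1\|\alpha)+\gamma\,\mathrm{KL}(\pi_2\|\beta),$$ where $\mathrm{KL}(\mu\|\nu)=\int\log\frac{d\mu}{d\nu}\,d\mu+\int d\nu-\int d\mu$, with value $+\infty$ unless $\mu\ll\nu$ and the integral is finite. The unbalanced optimal transport (UOT) problem is to minimize $J$. For $m_1,m_2\in\mathbb R^d$, $\Sigma_1,\Sigma_2\succ O$ and $c>0$ let $$M(m_1,m_2)=\|m_2-m_1\|^2+\tfrac\gamma2(m_1-m_\alpha)^\top\Sigma_\alpha^{-1}(m_1-m_\alpha)+\tfrac\gamma2(m_2-m_\beta)^\top\Sigma_\beta^{-1}(m_2-m_\beta),$$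 $$C(\Sigma_1,\Sigma_2)=-2\,\mathrm{Tr}\,(\Sigma_1^{1/2}\Sigma_2\Sigma_1^{1/2})^{1/2}+\tfrac\gamma2\mathrm{Tr}(\Sigma_\beta^{-1}\Sigma_2)-\tfrac\gamma2\log\det\Sigma_2+\mathrm{Tr}\,\Sigma_2+\tfrac\gamma2\mathrm{Tr}(\Sigma_\alpha^{-1}\Sigma_1)-\tfrac\gamma2\log\det\Sigma_1+\mathrm{Tr}\,\Sigma_1,$$ $$L=\log\det\Sigma_\alpha+\log\det\Sigma_\beta-2d,\qquad \psi(c)=\tfrac{c\gamma}2L+\gamma\phi_\alpha(c)+\gamma\phi_\beta(c),\qquad \phi_\nu(c)=c\log\tfrac c{c_\nu}-c+c_\nu .$$ The algorithm: (1) solve the subproblem $\min\{M(m_1,m_2)+C(\Sigma_1,\Sigma_2): m_1,m_2\in\mathbb R^d,\ \Sigma_1,\Sigma_2\succ O\}$; let $(m_1^*,\Sigma_1^*,m_2^*,\Sigma_2^*)$ be a solution and $p^*$ the optimal value; (2) set $c^*=\sqrt{c_\alpha c_\beta}\,\exp\!\left(-\frac{p^*}{2\gamma}-\frac L4\right)$.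 **Theorem (global optimality).** The subproblem is convex and has a solution, so the algorithm has an outcome. For every outcome, let $T=(\Sigma_1^*)^{-1/2}\big((\Sigma_1^*)^{1/2}\Sigma_2^*(\Sigma_1^*)^{1/2}\big)^{1/2}(\Sigma_1^*)^{-1/2}$, $t=m_2^*-Tm_1^*$, and let $\pi^*$ be the image of $c^*\mathcal N(m_1^*,\Sigma_1^*)$ under $x\mapsto(x,Tx+t)$. Then: 1. $\pi^*$ is a plan with marginals $c^*\mathcal N(m_1^*,\Sigma_1^*)$ and $c^*\mathcal N(m_2^*,\Sigma_2^*)$, and it is a globally optimal solution of the UOT problem: $J(\pi^*)\le J(\pi)$ for every plan $\pi$. Moreover $J(\pi^*)$ equals the infimum of $J$ over the plans that are absolutely continuous with respect to Lebesgue measure on $\mathbb R^{2d}$, and $J(\pi^*)=c^*p^*+\psi(c^*)<\infty$. 2. $(c^*,m_1^*,\Sigma_1^*,m_2^*,\Sigma_2^*)$ minimizes $c\,M(m_1,m_2)+c\,C(\Sigma_1,\Sigma_2)+\psi(c)$ over $c>0$, $m_1,m_2\in\mathbb R^d$, $\Sigma_1,\Sigma_2\succ O$, and the minimum is $c^*p^*+\psi(c^*)$.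 3. The function $c\mapsto c\,p^*+\psi(c)$ is convex on $(0,\infty)$, and $c^*$ is its unique minimizer. -/

import Mathlib

open MeasureTheory

namespace GaussianUOT

open scoped MatrixOrder ENNReal

noncomputable section

/-- `ℝ^d` with its Euclidean norm. -/
abbrev Vec (d : ℕ) : Type := EuclideanSpace ℝ (Fin d)

/-- Real `d × d` matrices. -/
abbrev Mat (d : ℕ) : Type := Matrix (Fin d) (Fin d) ℝ

/-- The finite measures on a normed space with finite `p`-th moment. On a product `X × Y` the norm
is the maximum norm; any equivalent norm gives the same set of measures. -/
def finiteMoment (p : ℕ) (X : Type*) [NormedAddCommGroup X] [MeasurableSpace X] :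
    Set (Measure X) :=
  {μ | IsFiniteMeasure μ ∧ ∫⁻ x, ‖x‖ₑ ^ p ∂μ < ∞}

/-- The Gaussian measure `c N(m, Σ)`; the mass `c` is meant to be nonnegative and the covariance
matrix positive semidefinite. -/
def gaussian {d : ℕ} (c : ℝ) (m : Vec d) (S : Mat d) : Measure (Vec d) :=
  ENNReal.ofReal c • ProbabilityTheory.multivariateGaussian m S

/-- The parameters `(c, m, Σ)` of a reference Gaussian measure `c N(m, Σ)`. -/
structure Ref (d : ℕ) where
  mass : ℝ
  mean : Vec d
  cov : Mat d

/-- Positive mass and positive definite covariance. -/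
structure Ref.Nondegenerate {d : ℕ} (ν : Ref d) : Prop where
  mass_pos : 0 < ν.mass
  cov_posDef : ν.cov.PosDef

/-- The reference measure with the given parameters. -/
def Ref.measure {d : ℕ} (ν : Ref d) : Measure (Vec d) := gaussian ν.mass ν.mean ν.cov

/-! ### The unbalanced transport problem over measures -/

/-- The admissible transport plans: finite measures on `ℝ^d × ℝ^d` with finite second moment. -/
def plans (d : ℕ) : Set (Measure (Vec d × Vec d)) := finiteMoment 2 (Vec d × Vec d)

/-- The admissible transport plans that have a density with respect to Lebesgue measure. -/
def acPlans (d : ℕ) : Set (Measure (Vec d × Vec d)) := {π | π ∈ plans d ∧ π ≪ volume}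

/-- The objective
`J(π) = ∫ ‖x₂ - x₁‖² dπ + γ KL(π₁ | α) + γ KL(π₂ | β)`, with values in `[0, ∞]`.
Here `KL(μ | ν) = ∫ log (dμ/dν) dμ + ν(ℝ^d) - μ(ℝ^d)`, which is `∞` unless `μ ≪ ν`. -/
def uotCost {d : ℕ} (γ : ℝ) (α β : Ref d) (π : Measure (Vec d × Vec d)) : ℝ≥0∞ :=
  ∫⁻ x, ENNReal.ofReal (‖x.2 - x.1‖ ^ 2) ∂π
    + ENNReal.ofReal γ * InformationTheory.klDiv π.fst α.measure
    + ENNReal.ofReal γ * InformationTheory.klDiv π.snd β.measure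

/-! ### The finite-dimensional problem -/

/-- The quadratic form `vᵀ A v`. -/
def quad {d : ℕ} (A : Mat d) (v : Vec d) : ℝ := v.ofLp ⬝ᵥ A.mulVec v.ofLp

/-- The mean cost `M(m₁, m₂)`. -/
def meanCost {d : ℕ} (γ : ℝ) (α β : Ref d) (m₁ m₂ : Vec d) : ℝ :=
  ‖m₂ - m₁‖ ^ 2
    + γ / 2 * quad α.cov⁻¹ (m₁ - α.mean)
    + γ / 2 * quad β.cov⁻¹ (m₂ - β.mean)

/-- The covariance cost `C(Σ₁, Σ₂)`, for positive definite `Σ₁`, `Σ₂`. -/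
def covCost {d : ℕ} (γ : ℝ) (α β : Ref d) (S₁ S₂ : Mat d) : ℝ :=
  -2 * (CFC.sqrt (CFC.sqrt S₁ * S₂ * CFC.sqrt S₁)).trace
    + γ / 2 * (β.cov⁻¹ * S₂).trace - γ / 2 * Real.log S₂.det + S₂.trace
    + γ / 2 * (α.cov⁻¹ * S₁).trace - γ / 2 * Real.log S₁.det + S₁.trace

/-- `L = log det Σ_α + log det Σ_β - 2d`. -/
def logDetConst {d : ℕ} (α β : Ref d) : ℝ := Real.log α.cov.det + Real.log β.cov.det - 2 * d

/-- `φ_ν(c) = c log (c / c_ν) - c + c_ν`. -/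
def phi {d : ℕ} (ν : Ref d) (c : ℝ) : ℝ := c * Real.log (c / ν.mass) - c + ν.mass

/-- The mass term `ψ(c)`. -/
def psi {d : ℕ} (γ : ℝ) (α β : Ref d) (c : ℝ) : ℝ :=
  c * γ / 2 * logDetConst α β + γ * phi α c + γ * phi β c

/-- Means and covariances `(m₁, Σ₁, m₂, Σ₂)`. -/
abbrev Moments (d : ℕ) : Type := Vec d × Mat d × Vec d × Mat d

/-- The domain of the subproblem: `Σ₁` and `Σ₂` are positive definite, as they must be for
`log det Σ₁` and `log det Σ₂` to be finite. -/
def momentDomain (d : ℕ) : Set (Moments d) := {q | q.2.1.PosDef ∧ q.2.2.2.PosDef}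

/-- The objective `M(m₁, m₂) + C(Σ₁, Σ₂)` of the subproblem. -/
def subObjective {d : ℕ} (γ : ℝ) (α β : Ref d) (q : Moments d) : ℝ :=
  meanCost γ α β q.1 q.2.2.1 + covCost γ α β q.2.1 q.2.2.2

/-- The objective `c M(m₁, m₂) + c C(Σ₁, Σ₂) + ψ(c)` of the finite-dimensional problem. -/
def finObjective {d : ℕ} (γ : ℝ) (α β : Ref d) (z : ℝ × Moments d) : ℝ :=
  z.1 * meanCost γ α β z.2.1 z.2.2.2.1 + z.1 * covCost γ α β z.2.2.1 z.2.2.2.2 + psi γ α β z.1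

/-- The domain `c > 0`, `Σ₁ ≻ 0`, `Σ₂ ≻ 0` of the finite-dimensional problem. -/
def finDomain (d : ℕ) : Set (ℝ × Moments d) := {z | 0 < z.1 ∧ z.2 ∈ momentDomain d}

/-! ### The algorithm -/

/-- `(q, p, c)` is a possible outcome of the two-stage algorithm: in the first stage, `q` solves the
subproblem and `p` is its optimal value; in the second stage, `c` is the mass computed from `p` in
closed form. -/
structure IsOutput {d : ℕ} (γ : ℝ) (α β : Ref d) (q : Moments d) (p c : ℝ) : Prop where
  mem : q ∈ momentDomain d
  value : subObjective γ α β q = p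
  optimal : IsLeast (subObjective γ α β '' momentDomain d) p
  mass : c = Real.sqrt (α.mass * β.mass) * Real.exp (-p / (2 * γ) - logDetConst α β / 4)

/-- The matrix `T = Σ₁^{-1/2} (Σ₁^{1/2} Σ₂ Σ₁^{1/2})^{1/2} Σ₁^{-1/2}`. -/
def transportMatrix {d : ℕ} (S₁ S₂ : Mat d) : Mat d :=
  (CFC.sqrt S₁)⁻¹ * CFC.sqrt (CFC.sqrt S₁ * S₂ * CFC.sqrt S₁) * (CFC.sqrt S₁)⁻¹

/-- The affine map `x ↦ T x + t` with `t = m₂ - T m₁`. -/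
def transportMap {d : ℕ} (q : Moments d) (x : Vec d) : Vec d :=
  Matrix.toEuclideanLin (transportMatrix q.2.1 q.2.2.2) x
    + (q.2.2.1 - Matrix.toEuclideanLin (transportMatrix q.2.1 q.2.2.2) q.1)

/-- The Gaussian plan with mass `c` and moments `q`: the law of `(x, T x + t)` when `x` is
distributed according to `c N(m₁, Σ₁)`. -/
def gaussianPlan {d : ℕ} (c : ℝ) (q : Moments d) : Measure (Vec d × Vec d) :=
  (gaussian c q.1 q.2.1).map fun x => (x, transportMap q x)

end

end GaussianUOT

open GaussianUOT

open scoped MatrixOrder ENNReal Matrix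

namespace GaussianUOT

open ProbabilityTheory InformationTheory

variable {d : ℕ}

/-! Fixing the mass, means and covariances of the two marginals reduces the problem to finite
dimension. The log-density of a Gaussian is quadratic, so its integral sees only moments, and
nonnegativity of the relative entropy shows that Gaussian marginals minimize both divergences
(`HasMoments.gaussianDiv_le_klDiv`). The transport cost obeys weak duality with quadratic
potentials: `‖x₂ - x₁‖²` minus the potentials is a complete square that vanishes on the graph of the
affine map (`norm_sub_sq_eq_dualPotential_add`). The Gaussian plan attains both bounds, so its cost
is `finObjective`.

For `c > 0` that objective is `c * subObjective + ψ(c)`, so the moments can be optimized before the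
mass. With optimal value `p`, the rest is a constant plus a positive multiple of `klFun (x / c)`,
minimal exactly at `x = c` (`IsOutput.massObjective_eq`).

The subproblem is convex because `-2 Tr (·)^{1/2}` and `-log det` are suprema of affine functions,
attained at `T` and at the inverse covariances. These minorants also give lower semicontinuity, and
coercivity of `Tr (A Σ) - log det Σ` then yields a minimizer.

Plans with a density reach the same infimum: mixing independent noise into the map with weights `cos
θ` and `sin θ` keeps both marginals and gives a density, and the cost converges as `θ → 0`. -/

/-! ### The transport matrix and trace inequalities -/

theorem posDef_sqrt {S : Mat d} (hS : S.PosDef) : (CFC.sqrt S).PosDef := by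
  have h0 : (CFC.sqrt S).PosSemidef := Matrix.nonneg_iff_posSemidef.1 (CFC.sqrt_nonneg S)
  rw [h0.posDef_iff_isUnit]
  have h : CFC.sqrt S * CFC.sqrt S = S := CFC.sqrt_mul_sqrt_self S hS.posSemidef.nonneg
  have hu := hS.isUnit
  rw [← h, Matrix.isUnit_iff_isUnit_det, Matrix.det_mul] at hu
  rw [Matrix.isUnit_iff_isUnit_det]
  exact isUnit_of_mul_isUnit_left hu

theorem trace_mul_nonneg {A B : Mat d} (hA : A.PosSemidef) (hB : B.PosSemidef) :
    0 ≤ (A * B).trace := by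
  have h : CFC.sqrt A * CFC.sqrt A = A := CFC.sqrt_mul_sqrt_self A hA.nonneg
  have h0 : (CFC.sqrt A).PosSemidef := Matrix.nonneg_iff_posSemidef.1 (CFC.sqrt_nonneg A)
  have h1 := (hB.mul_mul_conjTranspose_same (CFC.sqrt A)).trace_nonneg
  rw [h0.isHermitian.eq, mul_assoc, Matrix.trace_mul_comm, mul_assoc, h, Matrix.trace_mul_comm] at h1
  exact h1

/-- `Tr (Σ₁^{1/2} Σ₂ Σ₁^{1/2})^{1/2}`. -/
noncomputable def fidelity (S₁ S₂ : Mat d) : ℝ :=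
  (CFC.sqrt (CFC.sqrt S₁ * S₂ * CFC.sqrt S₁)).trace

theorem posDef_sqrt_mul_mul_sqrt {S₁ S₂ : Mat d} (h₁ : S₁.PosDef)
    (h₂ : S₂.PosDef) : (CFC.sqrt S₁ * S₂ * CFC.sqrt S₁).PosDef := by
  have hR := posDef_sqrt h₁
  have h := h₂.mul_mul_conjTranspose_same (B := CFC.sqrt S₁)
    (Matrix.vecMul_injective_of_isUnit hR.isUnit)
  rwa [hR.isHermitian.eq] at h

theorem posDef_transportMatrix {S₁ S₂ : Mat d} (h₁ : S₁.PosDef)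
    (h₂ : S₂.PosDef) : (transportMatrix S₁ S₂).PosDef := by
  have hR := (posDef_sqrt h₁).inv
  have h := (posDef_sqrt (posDef_sqrt_mul_mul_sqrt h₁ h₂)).mul_mul_conjTranspose_same
    (B := (CFC.sqrt S₁)⁻¹) (Matrix.vecMul_injective_of_isUnit hR.isUnit)
  rwa [hR.isHermitian.eq] at h

/-- A linear map `T` turns covariance `S₁` into `T S₁ Tᵀ`, so this is why the affine map sends one
marginal to the other. -/
theorem transportMatrix_mul_mul {S₁ S₂ : Mat d} (h₁ : S₁.PosDef)
    (h₂ : S₂.PosDef) : transportMatrix S₁ S₂ * S₁ * transportMatrix S₁ S₂ = S₂ := by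
  have hR := (Matrix.isUnit_iff_isUnit_det _).1 (posDef_sqrt h₁).isUnit
  have hG := CFC.sqrt_mul_sqrt_self _ (posDef_sqrt_mul_mul_sqrt h₁ h₂).posSemidef.nonneg
  have hS : CFC.sqrt S₁ * CFC.sqrt S₁ = S₁ := CFC.sqrt_mul_sqrt_self S₁ h₁.posSemidef.nonneg
  unfold transportMatrix
  set R := CFC.sqrt S₁
  set G := CFC.sqrt (R * S₂ * R)
  calc R⁻¹ * G * R⁻¹ * S₁ * (R⁻¹ * G * R⁻¹)
      = R⁻¹ * G * (R⁻¹ * R) * (R * R⁻¹) * G * R⁻¹ := by rw [← hS]; simp only [mul_assoc]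
    _ = R⁻¹ * (G * G) * R⁻¹ := by
        rw [Matrix.nonsing_inv_mul _ hR, Matrix.mul_nonsing_inv _ hR]; simp only [mul_assoc, one_mul]
    _ = (R⁻¹ * R) * S₂ * (R * R⁻¹) := by rw [hG]; simp only [mul_assoc]
    _ = S₂ := by rw [Matrix.nonsing_inv_mul _ hR, Matrix.mul_nonsing_inv _ hR, one_mul, mul_one]

theorem trace_transportMatrix_mul {S₁ : Mat d} (h₁ : S₁.PosDef) (S₂ : Mat d) : (transportMatrix S₁ S₂ * S₁).trace = fidelity S₁ S₂ := by
  have hR := (Matrix.isUnit_iff_isUnit_det _).1 (posDef_sqrt h₁).isUnit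
  have hS : CFC.sqrt S₁ * CFC.sqrt S₁ = S₁ := CFC.sqrt_mul_sqrt_self S₁ h₁.posSemidef.nonneg
  unfold transportMatrix fidelity
  set R := CFC.sqrt S₁
  set G := CFC.sqrt (R * S₂ * R)
  calc (R⁻¹ * G * R⁻¹ * S₁).trace = (R⁻¹ * G * (R⁻¹ * R) * R).trace := by
        rw [← hS]; simp only [mul_assoc]
    _ = (R⁻¹ * (G * R)).trace := by rw [Matrix.nonsing_inv_mul _ hR, mul_one, mul_assoc]
    _ = G.trace := by rw [Matrix.trace_mul_comm, mul_assoc, Matrix.mul_nonsing_inv _ hR, mul_one]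

theorem trace_transportMatrix_inv_mul {S₁ S₂ : Mat d} (h₁ : S₁.PosDef)
    (h₂ : S₂.PosDef) :
    ((transportMatrix S₁ S₂)⁻¹ * S₂).trace = fidelity S₁ S₂ := by
  have hT := (Matrix.isUnit_iff_isUnit_det _).1 (posDef_transportMatrix h₁ h₂).isUnit
  rw [← trace_transportMatrix_mul h₁ S₂]
  set T := transportMatrix S₁ S₂ with hTdef
  calc (T⁻¹ * S₂).trace = (T⁻¹ * T * S₁ * T).trace := by
        conv_lhs => rw [← transportMatrix_mul_mul h₁ h₂]
        simp only [← hTdef, mul_assoc]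
    _ = (T * S₁).trace := by rw [Matrix.nonsing_inv_mul _ hT, one_mul, Matrix.trace_mul_comm]

/-- Expand `0 ≤ Tr ((X - T) X⁻¹ (X - T) S₁)` and use `T S₁ T = S₂`. Equality holds at `X = T`. -/
theorem two_mul_fidelity_le {S₁ S₂ : Mat d} (h₁ : S₁.PosDef)
    (h₂ : S₂.PosDef) {X : Mat d} (hX : X.PosDef) :
    2 * fidelity S₁ S₂ ≤ (X * S₁).trace + (X⁻¹ * S₂).trace := by
  have hXu := (Matrix.isUnit_iff_isUnit_det _).1 hX.isUnit
  have hT := posDef_transportMatrix h₁ h₂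
  have hTS := transportMatrix_mul_mul h₁ h₂
  rw [← trace_transportMatrix_mul h₁ S₂]
  set T := transportMatrix S₁ S₂
  have hh : (X - T)ᴴ = X - T := by
    rw [Matrix.conjTranspose_sub, hX.isHermitian.eq, hT.isHermitian.eq]
  have hp := hX.inv.posSemidef.mul_mul_conjTranspose_same (X - T)
  rw [hh] at hp
  have h0 := trace_mul_nonneg hp h₁.posSemidef
  have he : (X - T) * X⁻¹ * (X - T) * S₁ = X * S₁ - T * S₁ - T * S₁ + T * (X⁻¹ * T * S₁) := by
    rw [sub_mul, Matrix.mul_nonsing_inv _ hXu, sub_mul, one_mul, mul_sub, mul_assoc T X⁻¹ X,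
      Matrix.nonsing_inv_mul _ hXu]
    noncomm_ring
  rw [he, Matrix.trace_add, Matrix.trace_sub, Matrix.trace_sub] at h0
  have h3 : (T * (X⁻¹ * T * S₁)).trace = (X⁻¹ * S₂).trace := by
    rw [Matrix.trace_mul_comm, ← hTS]; simp only [mul_assoc]
  rw [h3] at h0
  linarith

theorem log_det_le_trace_sub {S : Mat d} (hS : S.PosDef) : Real.log S.det ≤ S.trace - d := by
  have h1 := hS.isHermitian.det_eq_prod_eigenvalues
  have h2 := hS.isHermitian.trace_eq_sum_eigenvalues
  simp only [RCLike.ofReal_real_eq_id, id] at h1 h2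
  rw [h1, h2, Real.log_prod (fun i _ => (hS.eigenvalues_pos i).ne')]
  have : ∑ i, Real.log (hS.isHermitian.eigenvalues i)
      ≤ ∑ i, (hS.isHermitian.eigenvalues i - 1) :=
    Finset.sum_le_sum fun i _ => Real.log_le_sub_one_of_pos (hS.eigenvalues_pos i)
  simpa using this

/-- The tangent bound for the concave `log det`: apply the bound at the identity to `Y^{1/2} S
Y^{1/2}`. Equality holds at `Y = S⁻¹`. -/
theorem log_det_add_log_det_le {S Y : Mat d} (hS : S.PosDef) (hY : Y.PosDef) :
    Real.log S.det + Real.log Y.det ≤ (Y * S).trace - d := by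
  have h := log_det_le_trace_sub (posDef_sqrt_mul_mul_sqrt hY hS)
  have hs : CFC.sqrt Y * CFC.sqrt Y = Y := CFC.sqrt_mul_sqrt_self Y hY.posSemidef.nonneg
  have hd : (CFC.sqrt Y * S * CFC.sqrt Y).det = S.det * Y.det := by
    conv_rhs => rw [← hs]
    simp only [Matrix.det_mul]; ring
  rw [hd, Real.log_mul hS.det_pos.ne' hY.det_pos.ne', mul_assoc, Matrix.trace_mul_comm, mul_assoc,
    hs, Matrix.trace_mul_comm] at h
  exact h

theorem log_det_add_log_det_inv {S : Mat d} (hS : S.PosDef) :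
    Real.log S.det + Real.log S⁻¹.det = (S⁻¹ * S).trace - d := by
  rw [Matrix.nonsing_inv_mul _ ((Matrix.isUnit_iff_isUnit_det _).1 hS.isUnit), Matrix.det_nonsing_inv,
    Ring.inverse_eq_inv', Real.log_inv]
  simp

theorem exists_posSemidef_sub_smul_one {A : Mat d} (hA : A.PosDef) :
    ∃ a : ℝ, 0 < a ∧ (A - a • (1 : Mat d)).PosSemidef := by
  -- In dimension zero there is no least eigenvalue, but every matrix is zero.
  rcases isEmpty_or_nonempty (Fin d) with he | he
  · exact ⟨1, one_pos, by rw [Subsingleton.elim (A - _) 0]; exact .zero⟩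
  obtain ⟨i, hi⟩ := Finite.exists_min hA.isHermitian.eigenvalues
  refine ⟨hA.isHermitian.eigenvalues i, hA.eigenvalues_pos i, ?_⟩
  have h : algebraMap ℝ (Mat d) (hA.isHermitian.eigenvalues i) ≤ A := by
    refine algebraMap_le_of_le_spectrum (p := IsSelfAdjoint) (fun x hx => ?_) hA.isHermitian
    rw [hA.isHermitian.spectrum_real_eq_range_eigenvalues] at hx
    obtain ⟨j, rfl⟩ := hx
    exact hi j
  rwa [Matrix.le_iff, Algebra.algebraMap_eq_smul_one] at h

theorem mul_trace_le_trace_mul {A S : Mat d} {a : ℝ} (hA : (A - a • (1 : Mat d)).PosSemidef)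
    (hS : S.PosSemidef) : a * S.trace ≤ (A * S).trace := by
  have h := trace_mul_nonneg hA hS
  rw [sub_mul, Matrix.trace_sub, smul_mul_assoc, one_mul, Matrix.trace_smul, smul_eq_mul] at h
  linarith

/-- Testing on `eᵢ ± eⱼ` gives `2 |S i j| ≤ S i i + S j j`, and no diagonal entry exceeds the trace.
-/
theorem abs_apply_le_trace {S : Mat d} (hS : S.PosSemidef) (i j : Fin d) : |S i j| ≤ S.trace := by
  have hq : ∀ t : ℝ, 0 ≤ S i i + 2 * t * S i j + t ^ 2 * S j j := fun t => by
    have h := hS.dotProduct_mulVec_nonneg (Pi.single i 1 + t • Pi.single j 1)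
    have hs : S j i = S i j := by simpa using hS.isHermitian.apply i j
    simp [Matrix.mulVec_add, Matrix.mulVec_smul, add_dotProduct, hs] at h
    nlinarith
  have hd : ∀ k, 0 ≤ S k k := fun k => hS.diag_nonneg
  have ht : ∀ k, S k k ≤ S.trace := fun k =>
    Finset.single_le_sum (f := fun k => S k k) (fun k _ => hd k) (Finset.mem_univ k)
  have h1 := hq 1
  have h2 := hq (-1)
  rw [abs_le]
  constructor <;> linarith [ht i, ht j]

/-! ### The finite-dimensional problems -/

theorem quad_nonneg {A : Mat d} (hA : A.PosSemidef) (v : Vec d) : 0 ≤ quad A v := by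
  have := hA.dotProduct_mulVec_nonneg v.ofLp
  rwa [star_trivial] at this

theorem quad_one (v : Vec d) : quad 1 v = ‖v‖ ^ 2 := by
  rw [quad, Matrix.one_mulVec, EuclideanSpace.real_norm_sq_eq]
  simp [dotProduct, sq]

theorem quad_sub_left (A B : Mat d) (v : Vec d) : quad (A - B) v = quad A v - quad B v := by
  simp [quad, Matrix.sub_mulVec, dotProduct_sub]

theorem quad_smul_left (a : ℝ) (A : Mat d) (v : Vec d) : quad (a • A) v = a * quad A v := by
  simp [quad, Matrix.smul_mulVec, dotProduct_smul]

theorem continuous_quad (A : Mat d) : Continuous (quad A) := by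
  unfold quad
  simp only [dotProduct, Matrix.mulVec]
  fun_prop

theorem mul_norm_sq_le_quad {A : Mat d} {a : ℝ} (hA : (A - a • (1 : Mat d)).PosSemidef)
    (v : Vec d) : a * ‖v‖ ^ 2 ≤ quad A v := by
  have h := quad_nonneg hA v
  rw [quad_sub_left, quad_smul_left, quad_one] at h
  linarith

theorem quad_combo (A : Mat d) (x y : Vec d) {a b : ℝ} (hab : a + b = 1) :
    quad A (a • x + b • y) = a * quad A x + b * quad A y - a * b * quad A (x - y) := by
  obtain rfl : b = 1 - a := by linarith
  simp only [quad, WithLp.ofLp_add, WithLp.ofLp_smul, WithLp.ofLp_sub, Matrix.mulVec_add,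
    Matrix.mulVec_smul, Matrix.mulVec_sub, add_dotProduct, dotProduct_add, smul_dotProduct,
    dotProduct_smul, sub_dotProduct, dotProduct_sub, smul_eq_mul]
  ring

theorem convexOn_quad {A : Mat d} (hA : A.PosSemidef) (m : Vec d) :
    ConvexOn ℝ Set.univ fun v => quad A (v - m) := by
  refine ⟨convex_univ, fun x _ y _ a b ha hb hab => ?_⟩
  have : a • x + b • y - m = a • (x - m) + b • (y - m) := by
    obtain rfl : b = 1 - a := by linarith
    module
  simp only [this, smul_eq_mul]
  rw [quad_combo A _ _ hab]
  have := mul_nonneg (mul_nonneg ha hb) (quad_nonneg hA (x - m - (y - m)))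
  linarith

/-- The affine minorant of `covCost` with slopes given by `X`, `Y₁` and `Y₂`. -/
noncomputable def covMinorant (γ : ℝ) (α β : Ref d) (X Y₁ Y₂ S₁ S₂ : Mat d) : ℝ :=
  -((X * S₁).trace + (X⁻¹ * S₂).trace)
    + γ / 2 * (β.cov⁻¹ * S₂).trace - γ / 2 * ((Y₂ * S₂).trace - d - Real.log Y₂.det) + S₂.trace
    + γ / 2 * (α.cov⁻¹ * S₁).trace - γ / 2 * ((Y₁ * S₁).trace - d - Real.log Y₁.det) + S₁.trace

/-- The three nonlinear terms are bounded separately: the fidelity through `X`, each `log det`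
through its tangent. -/
theorem covMinorant_le {γ : ℝ} (hγ : 0 < γ) (α β : Ref d) {X Y₁ Y₂ S₁ S₂ : Mat d} (hX : X.PosDef)
    (hY₁ : Y₁.PosDef) (hY₂ : Y₂.PosDef) (h₁ : S₁.PosDef) (h₂ : S₂.PosDef) :
    covMinorant γ α β X Y₁ Y₂ S₁ S₂ ≤ covCost γ α β S₁ S₂ := by
  have hF := two_mul_fidelity_le h₁ h₂ hX
  have e₁ := mul_le_mul_of_nonneg_left (log_det_add_log_det_le h₁ hY₁) (half_pos hγ).le
  have e₂ := mul_le_mul_of_nonneg_left (log_det_add_log_det_le h₂ hY₂) (half_pos hγ).le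
  unfold covMinorant covCost
  rw [← fidelity]
  linarith

theorem covMinorant_self (γ : ℝ) (α β : Ref d) {S₁ S₂ : Mat d}
    (h₁ : S₁.PosDef) (h₂ : S₂.PosDef) :
    covMinorant γ α β (transportMatrix S₁ S₂) S₁⁻¹ S₂⁻¹ S₁ S₂ = covCost γ α β S₁ S₂ := by
  have e₁ := log_det_add_log_det_inv h₁
  have e₂ := log_det_add_log_det_inv h₂
  unfold covMinorant covCost
  rw [← fidelity, trace_transportMatrix_mul h₁, trace_transportMatrix_inv_mul h₁ h₂, ← e₁, ← e₂]
  ring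

theorem covMinorant_combo (γ : ℝ) (α β : Ref d) (X Y₁ Y₂ S₁ S₂ R₁ R₂ : Mat d) {a b : ℝ}
    (hab : a + b = 1) :
    covMinorant γ α β X Y₁ Y₂ (a • S₁ + b • R₁) (a • S₂ + b • R₂)
      = a * covMinorant γ α β X Y₁ Y₂ S₁ S₂ + b * covMinorant γ α β X Y₁ Y₂ R₁ R₂ := by
  obtain rfl : b = 1 - a := by linarith
  simp only [covMinorant, mul_add, Matrix.mul_smul, Matrix.trace_add, Matrix.trace_smul,
    smul_eq_mul]
  ring

theorem continuous_covMinorant (γ : ℝ) (α β : Ref d) (X Y₁ Y₂ : Mat d) :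
    Continuous fun q : Moments d => covMinorant γ α β X Y₁ Y₂ q.2.1 q.2.2.2 := by
  unfold covMinorant
  fun_prop

theorem continuous_meanCost (γ : ℝ) (α β : Ref d) :
    Continuous fun q : Moments d => meanCost γ α β q.1 q.2.2.1 := by
  unfold meanCost
  have h1 := continuous_quad α.cov⁻¹
  have h2 := continuous_quad β.cov⁻¹
  fun_prop

theorem Matrix.PosDef.combo {S R : Mat d} (hS : S.PosDef) (hR : R.PosDef) {a b : ℝ} (ha : 0 ≤ a)
    (hb : 0 ≤ b) (hab : a + b = 1) : (a • S + b • R).PosDef := by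
  rcases ha.eq_or_lt with rfl | ha
  · obtain rfl : b = 1 := by linarith
    simpa using hR
  · exact (hS.smul ha).add_posSemidef (hR.posSemidef.smul hb)

theorem convex_momentDomain : Convex ℝ (momentDomain d) := fun _ hx _ hy _ _ ha hb hab =>
  ⟨hx.1.combo hy.1 ha hb hab, hx.2.combo hy.2 ha hb hab⟩

/-- The affine minorant that touches `covCost` at the convex combination lies below it at both
endpoints. The mean cost is a sum of convex quadratics. -/
theorem convexOn_subObjective {γ : ℝ} (hγ : 0 < γ) {α β : Ref d} (hα : α.Nondegenerate)
    (hβ : β.Nondegenerate) : ConvexOn ℝ (momentDomain d) (subObjective γ α β) := by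
  refine ⟨convex_momentDomain, fun x hx y hy a b ha hb hab => ?_⟩
  have hz := convex_momentDomain hx hy ha hb hab
  have hT := posDef_transportMatrix hz.1 hz.2
  have hx' := mul_le_mul_of_nonneg_left
    (covMinorant_le hγ α β hT hz.1.inv hz.2.inv hx.1 hx.2) ha
  have hy' := mul_le_mul_of_nonneg_left
    (covMinorant_le hγ α β hT hz.1.inv hz.2.inv hy.1 hy.2) hb
  have hz' := covMinorant_self γ α β hz.1 hz.2
  have hc := covMinorant_combo γ α β (transportMatrix (a • x + b • y).2.1 (a • x + b • y).2.2.2)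
    (a • x + b • y).2.1⁻¹ (a • x + b • y).2.2.2⁻¹ x.2.1 x.2.2.2 y.2.1 y.2.2.2 hab
  have hqα := (convexOn_quad hα.cov_posDef.inv.posSemidef α.mean).2
    (Set.mem_univ x.1) (Set.mem_univ y.1) ha hb hab
  have hqβ := (convexOn_quad hβ.cov_posDef.inv.posSemidef β.mean).2
    (Set.mem_univ x.2.2.1) (Set.mem_univ y.2.2.1) ha hb hab
  have hq := (convexOn_quad (Matrix.PosSemidef.one (n := Fin d) (R := ℝ)) 0).2
    (Set.mem_univ (x.2.2.1 - x.1)) (Set.mem_univ (y.2.2.1 - y.1)) ha hb hab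
  simp only [quad_one, sub_zero] at hq
  have hd : (a • x + b • y).2.2.1 - (a • x + b • y).1
      = a • (x.2.2.1 - x.1) + b • (y.2.2.1 - y.1) := by
    simp only [Prod.fst_add, Prod.snd_add, Prod.smul_fst, Prod.smul_snd, smul_sub]; abel
  have hqα' := mul_le_mul_of_nonneg_left hqα (half_pos hγ).le
  have hqβ' := mul_le_mul_of_nonneg_left hqβ (half_pos hγ).le
  simp only [smul_eq_mul] at *
  rw [subObjective, ← hz', meanCost, hd]
  simp only [subObjective, meanCost, Prod.fst_add, Prod.snd_add, Prod.smul_fst, Prod.smul_snd] at *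
  linarith

/-- The minorant touching at `q` is continuous, which bypasses continuity of the matrix square root.
-/
theorem lowerSemicontinuousOn_subObjective {γ : ℝ} (hγ : 0 < γ) (α β : Ref d) :
    LowerSemicontinuousOn (subObjective γ α β) (momentDomain d) := by
  intro q hq y hy
  have hT := posDef_transportMatrix hq.1 hq.2
  have hc := (continuous_meanCost γ α β).add (continuous_covMinorant γ α β
    (transportMatrix q.2.1 q.2.2.2) q.2.1⁻¹ q.2.2.2⁻¹)
  have he : y < meanCost γ α β q.1 q.2.2.1 + covMinorant γ α β
      (transportMatrix q.2.1 q.2.2.2) q.2.1⁻¹ q.2.2.2⁻¹ q.2.1 q.2.2.2 := by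
    rw [covMinorant_self γ α β hq.1 hq.2]; exact hy
  filter_upwards [nhdsWithin_le_nhds (hc.continuousAt.eventually (lt_mem_nhds he)),
    self_mem_nhdsWithin] with r hr hrd
  have := covMinorant_le hγ α β hT hq.1.inv hq.2.inv hrd.1 hrd.2
  simp only [Pi.add_apply] at hr
  unfold subObjective
  linarith

/-! ### Compactness and existence of a minimizer -/

theorem isClosed_posSemidef : IsClosed {S : Mat d | S.PosSemidef} := by
  have : {S : Mat d | S.PosSemidef}
      = {S | Sᴴ = S} ∩ ⋂ x : Fin d → ℝ, {S | 0 ≤ star x ⬝ᵥ (S *ᵥ x)} := by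
    ext S
    simp only [Set.mem_ofPred_eq, Matrix.posSemidef_iff_dotProduct_mulVec, Set.mem_inter_iff,
      Set.mem_iInter]
    rfl
  rw [this]
  refine (isClosed_eq (by fun_prop) continuous_id).inter (isClosed_iInter fun x => ?_)
  exact isClosed_le continuous_const (by fun_prop)

/-- The trace bounds every entry. For `δ > 0` the determinant condition keeps the set inside the
positive definite matrices. -/
theorem isCompact_posSemidef_trace_le_det_ge (C δ : ℝ) :
    IsCompact {S : Mat d | S.PosSemidef ∧ S.trace ≤ C ∧ δ ≤ S.det} := by
  have hbox : IsCompact (Set.pi Set.univ fun _ : Fin d => Set.pi Set.univ fun _ : Fin d =>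
      Set.Icc (-C) C) := isCompact_univ_pi fun i => isCompact_univ_pi fun j => isCompact_Icc
  refine IsCompact.of_isClosed_subset (X := Mat d) hbox ?_ fun S hS i _ j _ => ?_
  · exact isClosed_posSemidef.inter ((isClosed_le continuous_id.matrix_trace continuous_const).inter
      (isClosed_le continuous_const continuous_id.matrix_det))
  · exact abs_le.1 ((abs_apply_le_trace hS.1 i j).trans hS.2.1)

/-- Lower bounds for `Tr (A Σ) - log det Σ`. -/
theorem exists_coercive_bound {A : Mat d} (hA : A.PosDef) :
    ∃ k a b : ℝ, 0 < a ∧ ∀ S : Mat d, S.PosDef →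
      k ≤ (A * S).trace - Real.log S.det ∧
      a * S.trace - b ≤ (A * S).trace - Real.log S.det ∧
      -Real.log S.det ≤ (A * S).trace - Real.log S.det := by
  obtain ⟨a, ha, haA⟩ := exists_posSemidef_sub_smul_one hA
  refine ⟨d + Real.log A.det, a / 2, -(d + Real.log ((1 / 2 : ℝ) • A).det), half_pos ha,
    fun S hS => ?_⟩
  have h1 := log_det_add_log_det_le hS hA
  -- Half of `Tr (A S)` absorbs `log det S`; the other half controls the trace.
  have h2 := log_det_add_log_det_le hS (hA.smul (show (0 : ℝ) < 1 / 2 by norm_num))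
  rw [smul_mul_assoc, Matrix.trace_smul, smul_eq_mul] at h2
  have h3 := mul_trace_le_trace_mul haA hS.posSemidef
  have h4 := trace_mul_nonneg hA.posSemidef hS.posSemidef
  refine ⟨by linarith, by linarith, by linarith⟩

theorem exists_minimizer_subObjective {γ : ℝ} (hγ : 0 < γ) {α β : Ref d} (hα : α.Nondegenerate)
    (hβ : β.Nondegenerate) :
    ∃ q ∈ momentDomain d, ∀ r ∈ momentDomain d, subObjective γ α β q ≤ subObjective γ α β r := by
  obtain ⟨k₁, a₁, b₁, ha₁, hk₁⟩ := exists_coercive_bound hα.cov_posDef.inv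
  obtain ⟨k₂, a₂, b₂, ha₂, hk₂⟩ := exists_coercive_bound hβ.cov_posDef.inv
  obtain ⟨l₁, hl₁, hq₁⟩ := exists_posSemidef_sub_smul_one hα.cov_posDef.inv
  obtain ⟨l₂, hl₂, hq₂⟩ := exists_posSemidef_sub_smul_one hβ.cov_posDef.inv
  let q₀ : Moments d := (0, 1, 0, 1)
  have hq₀ : q₀ ∈ momentDomain d := ⟨Matrix.PosDef.one, Matrix.PosDef.one⟩
  set r := 2 / γ * subObjective γ α β q₀ with hr
  -- Each bound isolates one summand of the sublevel inequality, the others being at least `k₁`,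
  -- `k₂` or `0`.
  let K : Set (Moments d) := Metric.closedBall α.mean (Real.sqrt ((r - k₁ - k₂) / l₁)) ×ˢ
    {S : Mat d | S.PosSemidef ∧ S.trace ≤ (r - k₂ + b₁) / a₁ ∧ Real.exp (-(r - k₂)) ≤ S.det} ×ˢ
    Metric.closedBall β.mean (Real.sqrt ((r - k₁ - k₂) / l₂)) ×ˢ
    {S : Mat d | S.PosSemidef ∧ S.trace ≤ (r - k₁ + b₂) / a₂ ∧ Real.exp (-(r - k₁)) ≤ S.det}
  have hK : IsCompact K := (isCompact_closedBall _ _).prod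
    ((isCompact_posSemidef_trace_le_det_ge _ _).prod ((isCompact_closedBall _ _).prod
      (isCompact_posSemidef_trace_le_det_ge _ _)))
  have hKd : K ⊆ momentDomain d := fun q hq =>
    ⟨hq.2.1.1.posDef_iff_det_ne_zero.2 ((Real.exp_pos _).trans_le hq.2.1.2.2).ne',
      hq.2.2.2.1.posDef_iff_det_ne_zero.2 ((Real.exp_pos _).trans_le hq.2.2.2.2.2).ne'⟩
  have hsub : ∀ q ∈ momentDomain d, subObjective γ α β q ≤ subObjective γ α β q₀ → q ∈ K := by
    intro q hq hle
    obtain ⟨m₁, S₁, m₂, S₂⟩ := q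
    obtain ⟨h₁, h₂⟩ : S₁.PosDef ∧ S₂.PosDef := hq
    obtain ⟨u1, u2, u3⟩ := hk₁ S₁ h₁
    obtain ⟨v1, v2, v3⟩ := hk₂ S₂ h₂
    have w1 := mul_norm_sq_le_quad hq₁ (m₁ - α.mean)
    have w2 := mul_norm_sq_le_quad hq₂ (m₂ - β.mean)
    have w1' : 0 ≤ l₁ * ‖m₁ - α.mean‖ ^ 2 := by positivity
    have w2' : 0 ≤ l₂ * ‖m₂ - β.mean‖ ^ 2 := by positivity
    -- With `X = 1`, the terms `Tr S₁ + Tr S₂` dominate the negative fidelity term, leaving `γ / 2`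
    -- times the coercive part.
    have hF := two_mul_fidelity_le h₁ h₂ (X := 1) Matrix.PosDef.one
    rw [inv_one, one_mul, one_mul] at hF
    have hn : 0 ≤ ‖m₂ - m₁‖ ^ 2 := by positivity
    have hle' : quad α.cov⁻¹ (m₁ - α.mean) + quad β.cov⁻¹ (m₂ - β.mean)
        + ((α.cov⁻¹ * S₁).trace - Real.log S₁.det) + ((β.cov⁻¹ * S₂).trace - Real.log S₂.det)
        ≤ r := by
      rw [hr, div_mul_eq_mul_div, le_div_iff₀ hγ]
      have : meanCost γ α β m₁ m₂ + covCost γ α β S₁ S₂ ≤ subObjective γ α β q₀ := hle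
      unfold meanCost covCost at this
      rw [← fidelity] at this
      linarith
    refine ⟨?_, ⟨h₁.posSemidef, ?_, ?_⟩, ?_, ⟨h₂.posSemidef, ?_, ?_⟩⟩
    · rw [Metric.mem_closedBall, dist_eq_norm]
      refine Real.le_sqrt_of_sq_le ?_
      rw [le_div_iff₀ hl₁]
      dsimp only
      linarith
    · dsimp only
      rw [le_div_iff₀ ha₁]; linarith
    · dsimp only
      rw [← Real.le_log_iff_exp_le h₁.det_pos]; linarith
    · rw [Metric.mem_closedBall, dist_eq_norm]
      refine Real.le_sqrt_of_sq_le ?_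
      rw [le_div_iff₀ hl₂]
      dsimp only
      linarith
    · dsimp only
      rw [le_div_iff₀ ha₂]; linarith
    · dsimp only
      rw [← Real.le_log_iff_exp_le h₂.det_pos]; linarith
  obtain ⟨q, hq, hmin⟩ := ((lowerSemicontinuousOn_subObjective hγ α β).mono hKd).exists_isMinOn
    ⟨q₀, hsub q₀ hq₀ le_rfl⟩ hK
  refine ⟨q, hKd hq, fun s hs => ?_⟩
  rcases le_total (subObjective γ α β s) (subObjective γ α β q₀) with h | h
  · exact hmin (hsub s hs h)
  · exact (hmin (hsub q₀ hq₀ le_rfl)).trans h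

theorem exists_isOutput {γ : ℝ} (hγ : 0 < γ) {α β : Ref d} (hα : α.Nondegenerate)
    (hβ : β.Nondegenerate) : ∃ (q : Moments d) (p c : ℝ), IsOutput γ α β q p c := by
  obtain ⟨q, hq, hmin⟩ := exists_minimizer_subObjective hγ hα hβ
  exact ⟨q, _, _, hq, rfl, ⟨⟨q, hq, rfl⟩, Set.forall_mem_image.2 hmin⟩, rfl⟩

/-! ### The mass problem -/

theorem IsOutput.mass_pos {γ : ℝ} {α β : Ref d} (hα : α.Nondegenerate)
    (hβ : β.Nondegenerate) {q : Moments d} {p c : ℝ} (h : IsOutput γ α β q p c) : 0 < c := by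
  rw [h.mass]
  have := mul_pos hα.mass_pos hβ.mass_pos
  positivity

/-- The closed form of `c` is the zero of the derivative, which is therefore `2 γ log (x / c)`; the
constant is fixed by the limit `γ (c_α + c_β)` as `x → 0`. -/
theorem IsOutput.massObjective_eq {γ : ℝ} (hγ : 0 < γ) {α β : Ref d} (hα : α.Nondegenerate)
    (hβ : β.Nondegenerate) {q : Moments d} {p c : ℝ} (h : IsOutput γ α β q p c) {x : ℝ}
    (hx : 0 < x) :
    x * p + psi γ α β x
      = 2 * γ * c * klFun (x / c) + γ * (α.mass + β.mass - 2 * c) := by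
  have hc := h.mass_pos hα hβ
  have hab := mul_pos hα.mass_pos hβ.mass_pos
  have hlog : Real.log c = (Real.log α.mass + Real.log β.mass) / 2
      + (-p / (2 * γ) - logDetConst α β / 4) := by
    rw [h.mass, Real.log_mul (Real.sqrt_pos.2 hab).ne' (Real.exp_pos _).ne', Real.log_exp,
      Real.log_sqrt hab.le, Real.log_mul hα.mass_pos.ne' hβ.mass_pos.ne']
  rw [klFun, psi, phi, phi, Real.log_div hx.ne' hc.ne', Real.log_div hx.ne' hα.mass_pos.ne',
    Real.log_div hx.ne' hβ.mass_pos.ne', hlog]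
  field_simp
  ring

theorem IsOutput.massObjective_lt {γ : ℝ} (hγ : 0 < γ) {α β : Ref d} (hα : α.Nondegenerate)
    (hβ : β.Nondegenerate) {q : Moments d} {p c : ℝ} (h : IsOutput γ α β q p c) {x : ℝ}
    (hx : 0 < x) (hxc : x ≠ c) : c * p + psi γ α β c < x * p + psi γ α β x := by
  have hc := h.mass_pos hα hβ
  rw [h.massObjective_eq hγ hα hβ hx, h.massObjective_eq hγ hα hβ hc, div_self hc.ne', klFun_one]
  have h0 : 0 < klFun (x / c) := (klFun_nonneg (by positivity)).lt_of_ne fun he =>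
    hxc ((div_eq_one_iff_eq hc.ne').1 ((klFun_eq_zero_iff (by positivity)).1 he.symm))
  have : 0 < 2 * γ * c * klFun (x / c) := by positivity
  linarith

theorem IsOutput.massObjective_le {γ : ℝ} (hγ : 0 < γ) {α β : Ref d} (hα : α.Nondegenerate)
    (hβ : β.Nondegenerate) {q : Moments d} {p c : ℝ} (h : IsOutput γ α β q p c) {x : ℝ}
    (hx : 0 < x) : c * p + psi γ α β c ≤ x * p + psi γ α β x := by
  by_cases hxc : x = c
  · rw [hxc]
  · exact (h.massObjective_lt hγ hα hβ hx hxc).le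

theorem IsOutput.convexOn_massObjective {γ : ℝ} (hγ : 0 < γ) {α β : Ref d} (hα : α.Nondegenerate)
    (hβ : β.Nondegenerate) {q : Moments d} {p c : ℝ} (h : IsOutput γ α β q p c) :
    ConvexOn ℝ (Set.Ioi 0) (fun x : ℝ => x * p + psi γ α β x) := by
  have hc := h.mass_pos hα hβ
  refine ⟨convex_Ioi 0, fun x hx y hy a b ha hb hab => ?_⟩
  have hz : a • x + b • y ∈ Set.Ioi (0 : ℝ) := convex_Ioi 0 hx hy ha hb hab
  dsimp only
  rw [h.massObjective_eq hγ hα hβ hx, h.massObjective_eq hγ hα hβ hy,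
    h.massObjective_eq hγ hα hβ hz]
  rw [Set.mem_Ioi] at hx hy
  have hk := convexOn_klFun.2 (x := x / c) (y := y / c) (by simp only [Set.mem_Ici]; positivity)
    (by simp only [Set.mem_Ici]; positivity) ha hb hab
  have he : (a • x + b • y) / c = a • (x / c) + b • (y / c) := by
    simp only [smul_eq_mul]; ring
  rw [he]
  have := mul_le_mul_of_nonneg_left hk (show 0 ≤ 2 * γ * c by positivity)
  simp only [smul_eq_mul] at this ⊢
  obtain rfl : b = 1 - a := by linarith
  linarith

theorem finObjective_eq (γ : ℝ) (α β : Ref d) (z : ℝ × Moments d) :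
    finObjective γ α β z = z.1 * subObjective γ α β z.2 + psi γ α β z.1 := by
  rw [finObjective, subObjective]; ring

theorem IsOutput.le_finObjective {γ : ℝ} (hγ : 0 < γ) {α β : Ref d} (hα : α.Nondegenerate)
    (hβ : β.Nondegenerate) {q : Moments d} {p c : ℝ} (h : IsOutput γ α β q p c)
    {z : ℝ × Moments d} (hz : z ∈ finDomain d) :
    c * p + psi γ α β c ≤ finObjective γ α β z := by
  refine (h.massObjective_le hγ hα hβ hz.1).trans ?_
  rw [finObjective_eq]
  have := mul_le_mul_of_nonneg_left (h.optimal.2 ⟨z.2, hz.2, rfl⟩) hz.1.le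
  linarith

/-! ### Gaussian densities -/

/-- The logarithm of the Lebesgue density of `N(m, Σ)`. -/
noncomputable def logDensity (m : Vec d) (S : Mat d) (x : Vec d) : ℝ :=
  -(1 / 2) * quad S⁻¹ (x - m) - 1 / 2 * Real.log S.det - d / 2 * Real.log (2 * Real.pi)

theorem continuous_logDensity (m : Vec d) (S : Mat d) : Continuous (logDensity m S) := by
  unfold logDensity
  have := continuous_quad S⁻¹
  fun_prop

/-- Both sides are finite measures with the same characteristic function, by the Gaussian Fourier
integral. -/
theorem stdGaussian_eq_withDensity : stdGaussian (Vec d)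
    = volume.withDensity fun x => ENNReal.ofReal (Real.exp (logDensity 0 1 x)) := by
  have hform : ∀ x : Vec d, Real.exp (logDensity 0 1 x)
      = Real.exp (-(d / 2 * Real.log (2 * Real.pi))) * Real.exp (-(1 / 2) * ‖x‖ ^ 2) := fun x => by
    rw [logDensity, inv_one, quad_one, sub_zero, Matrix.det_one, Real.log_one, ← Real.exp_add]
    ring_nf
  have hint : Integrable fun x : Vec d => Real.exp (logDensity 0 1 x) := by
    simp_rw [hform]
    refine Integrable.const_mul ?_ _
    have := (GaussianFourier.integrable_cexp_neg_mul_sq_norm_add (b := 1 / 2) (by norm_num) 0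
      (0 : Vec d)).norm
    refine this.congr (Filter.Eventually.of_forall fun x => ?_)
    simp only [Complex.norm_exp]
    congr 1
    simp [← Complex.ofReal_pow]
  have : IsFiniteMeasure (volume.withDensity fun x : Vec d =>
      ENNReal.ofReal (Real.exp (logDensity 0 1 x))) :=
    isFiniteMeasure_withDensity_ofReal hint.2
  apply Measure.ext_of_charFun
  ext t
  have hm : Measurable fun x : Vec d => ENNReal.ofReal (Real.exp (logDensity 0 1 x)) :=
    ((continuous_logDensity 0 1).rexp.measurable).ennreal_ofReal
  rw [charFun_stdGaussian, charFun_apply, integral_withDensity_eq_integral_toReal_smul hm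
    (Filter.Eventually.of_forall fun x => ENNReal.ofReal_lt_top)]
  have hG := GaussianFourier.integral_cexp_neg_mul_sq_norm_add (b := 1 / 2) (by norm_num)
    Complex.I t
  have hcongr : ∀ x : Vec d, (ENNReal.ofReal (Real.exp (logDensity 0 1 x))).toReal
      • Complex.exp (inner ℝ x t * Complex.I)
      = (Real.exp (-(d / 2 * Real.log (2 * Real.pi))) : ℂ)
        * Complex.exp (-(1 / 2) * ‖x‖ ^ 2 + Complex.I * inner ℝ t x) := fun x => by
    rw [ENNReal.toReal_ofReal (Real.exp_pos _).le, hform, Complex.real_smul, Complex.ofReal_mul,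
      mul_assoc, Complex.ofReal_exp (-(1 / 2) * ‖x‖ ^ 2), ← Complex.exp_add, real_inner_comm]
    push_cast
    ring_nf
  simp_rw [hcongr]
  rw [integral_const_mul, hG]
  have hpi : (Real.pi / (1 / 2) : ℂ) ^ (Module.finrank ℝ (Vec d) / 2 : ℂ)
      = (Real.exp (d / 2 * Real.log (2 * Real.pi)) : ℂ) := by
    have h2 : (Real.pi / (1 / 2) : ℂ) = ((2 * Real.pi : ℝ) : ℂ) := by push_cast; ring
    rw [h2, Complex.cpow_def_of_ne_zero (by exact_mod_cast (by positivity)),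
      ← Complex.ofReal_log (by positivity)]
    simp only [finrank_euclideanSpace, Fintype.card_fin]
    push_cast
    ring_nf
  rw [hpi, ← mul_assoc, ← Complex.ofReal_mul, ← Real.exp_add, neg_add_cancel, Real.exp_zero,
    Complex.ofReal_one, one_mul]
  congr 1
  rw [Complex.I_sq]
  ring

theorem map_withDensity_equiv {X Y : Type*} [MeasurableSpace X] [MeasurableSpace Y]
    (μ : Measure X) (e : X ≃ᵐ Y) (f : X → ℝ≥0∞) :
    (μ.withDensity f).map e = (μ.map e).withDensity (f ∘ e.symm) := by
  ext s hs
  rw [e.map_apply, withDensity_apply _ (e.measurable hs), withDensity_apply _ hs,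
    e.restrict_map, lintegral_map_equiv]
  simp

theorem quad_mulVec (A B : Mat d) (v : Vec d) :
    quad A (Matrix.toEuclideanLin B v) = quad (Bᵀ * A * B) v := by
  simp only [quad, Matrix.ofLp_toLpLin, Matrix.toLin'_apply, ← Matrix.mulVec_mulVec,
    Matrix.dotProduct_mulVec, Matrix.vecMul_transpose]

/-- Change of variables under `x ↦ m + S^{1/2} x`, whose Jacobian supplies the `log det` term. -/
theorem multivariateGaussian_eq_withDensity (m : Vec d) {S : Mat d} (hS : S.PosDef) :
    multivariateGaussian m S
      = volume.withDensity fun x => ENNReal.ofReal (Real.exp (logDensity m S x)) := by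
  have hR := posDef_sqrt hS
  have hRu := (Matrix.isUnit_iff_isUnit_det _).1 hR.isUnit
  have hRS : CFC.sqrt S * CFC.sqrt S = S := CFC.sqrt_mul_sqrt_self S hS.posSemidef.nonneg
  set R := CFC.sqrt S with hRdef
  let L : Vec d ≃ₗ[ℝ] Vec d := LinearEquiv.ofLinearMap (Matrix.toEuclideanLin R)
    (Matrix.toEuclideanLin R⁻¹)
    (by rw [← Matrix.toLpLin_mul_same, Matrix.mul_nonsing_inv _ hRu, Matrix.toLpLin_one])
    (by rw [← Matrix.toLpLin_mul_same, Matrix.nonsing_inv_mul _ hRu, Matrix.toLpLin_one])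
  let e₁ : Vec d ≃ᵐ Vec d := L.toContinuousLinearEquiv.toHomeomorph.toMeasurableEquiv
  let e₂ : Vec d ≃ᵐ Vec d := MeasurableEquiv.addLeft m
  have hdef : multivariateGaussian m S = (stdGaussian (Vec d)).map (e₁.trans e₂) := rfl
  have hdetL : LinearMap.det (Matrix.toEuclideanLin R : Vec d →ₗ[ℝ] Vec d) = R.det :=
    LinearMap.det_toLpLin _ _
  have hvol₁ : (volume : Measure (Vec d)).map e₁ = ENNReal.ofReal |R.det⁻¹| • volume := by
    have := Measure.map_linearMap_addHaar_eq_smul_addHaar (volume : Measure (Vec d))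
      (f := Matrix.toEuclideanLin R) (by rw [hdetL]; exact hR.det_pos.ne')
    rwa [hdetL] at this
  have hvol₂ : (volume : Measure (Vec d)).map e₂ = volume := map_add_left_eq_self volume m
  have hvol : (volume : Measure (Vec d)).map (e₁.trans e₂)
      = ENNReal.ofReal |R.det⁻¹| • volume := by
    rw [MeasurableEquiv.coe_trans, ← Measure.map_map e₂.measurable e₁.measurable, hvol₁,
      Measure.map_smul, hvol₂]
  rw [hdef, stdGaussian_eq_withDensity, map_withDensity_equiv, hvol, withDensity_smul_measure,
    ← withDensity_smul' _ _ ENNReal.ofReal_ne_top]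
  congr 1
  ext x
  have hdet : Real.log R.det = 1 / 2 * Real.log S.det := by
    rw [← hRS, Matrix.det_mul, Real.log_mul hR.det_pos.ne' hR.det_pos.ne']; ring
  have hinv : R⁻¹ᵀ * 1 * R⁻¹ = S⁻¹ := by
    rw [Matrix.transpose_nonsing_inv, mul_one, ← hRS, Matrix.mul_inv_rev]
    congr 2
    exact hR.isHermitian.eq
  have hsymm : (e₁.trans e₂).symm x = Matrix.toEuclideanLin R⁻¹ (x - m) := by
    change Matrix.toEuclideanLin R⁻¹ (-m + x) = _
    rw [neg_add_eq_sub]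
  simp only [Pi.smul_apply, Function.comp_apply, smul_eq_mul, hsymm]
  rw [abs_of_pos (inv_pos.2 hR.det_pos), ← ENNReal.ofReal_mul (inv_pos.2 hR.det_pos).le]
  congr 1
  rw [← Real.exp_log (inv_pos.2 hR.det_pos), ← Real.exp_add, Real.log_inv, hdet]
  congr 1
  rw [logDensity, logDensity, sub_zero, inv_one, quad_mulVec, hinv, Matrix.det_one, Real.log_one]
  ring

/-! ### First and second moments -/

/-- `μ` has mass `c`, mean `m` and covariance `Σ`. -/
structure HasMoments (μ : Measure (Vec d)) (c : ℝ) (m : Vec d) (S : Mat d) : Prop where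
  finite : IsFiniteMeasure μ
  mass : μ.real Set.univ = c
  integrable : ∀ i, Integrable (fun x : Vec d => x i - m i) μ
  integrable_mul : ∀ i j, Integrable (fun x : Vec d => (x i - m i) * (x j - m j)) μ
  mean : ∀ i, ∫ x : Vec d, (x i - m i) ∂μ = 0
  cov : ∀ i j, ∫ x : Vec d, (x i - m i) * (x j - m j) ∂μ = c * S i j

/-- Expanding about `m` instead of `a` leaves only centred moments to integrate. -/
theorem quad_sub_eq_sum (A : Mat d) (x m a : Vec d) :
    quad A (x - a) = ∑ i, ∑ j, (A i j * ((x i - m i) * (x j - m j))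
      + A i j * (m j - a j) * (x i - m i) + A i j * (m i - a i) * (x j - m j)
      + A i j * ((m i - a i) * (m j - a j))) := by
  simp only [quad, dotProduct, Matrix.mulVec, Finset.mul_sum]
  refine Finset.sum_congr rfl fun i _ => Finset.sum_congr rfl fun j _ => ?_
  simp only [WithLp.ofLp_sub, Pi.sub_apply]
  ring

namespace HasMoments

variable {μ : Measure (Vec d)} {c : ℝ} {m : Vec d} {S : Mat d}

theorem integrable_quad (h : HasMoments μ c m S) (A : Mat d) (a : Vec d) :
    Integrable (fun x => quad A (x - a)) μ := by
  have := h.finite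
  simp only [quad_sub_eq_sum A _ m a]
  exact integrable_finsetSum _ fun i _ => integrable_finsetSum _ fun j _ =>
    ((((h.integrable_mul i j).const_mul _).add ((h.integrable i).const_mul _)).add
      ((h.integrable j).const_mul _)).add (integrable_const _)

theorem integral_quad (h : HasMoments μ c m S) (hS : S.IsHermitian) (A : Mat d) (a : Vec d) :
    ∫ x, quad A (x - a) ∂μ = c * ((A * S).trace + quad A (m - a)) := by
  have := h.finite
  simp only [quad_sub_eq_sum A _ m a]
  have e : ∀ i j, ∫ x : Vec d, (A i j * ((x i - m i) * (x j - m j))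
      + A i j * (m j - a j) * (x i - m i) + A i j * (m i - a i) * (x j - m j)
      + A i j * ((m i - a i) * (m j - a j))) ∂μ
      = c * (A i j * S j i + A i j * ((m i - a i) * (m j - a j))) := fun i j => by
    have i1 := (h.integrable_mul i j).const_mul (A i j)
    have i2 := (h.integrable i).const_mul (A i j * (m j - a j))
    have i3 := (h.integrable j).const_mul (A i j * (m i - a i))
    have hs : S j i = S i j := by simpa using hS.apply i j
    rw [integral_add, integral_add, integral_add, integral_const_mul, integral_const_mul,
      integral_const_mul, h.mean, h.mean, h.cov, integral_const, h.mass, smul_eq_mul, hs]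
    · ring
    exacts [i1, i2, i1.add i2, i3, (i1.add i2).add i3, integrable_const _]
  have i : ∀ i j, Integrable (fun x : Vec d => A i j * ((x i - m i) * (x j - m j))
      + A i j * (m j - a j) * (x i - m i) + A i j * (m i - a i) * (x j - m j)
      + A i j * ((m i - a i) * (m j - a j))) μ := fun i j =>
    ((((h.integrable_mul i j).const_mul _).add ((h.integrable i).const_mul _)).add
      ((h.integrable j).const_mul _)).add (integrable_const _)
  rw [integral_finsetSum _ fun i' _ => integrable_finsetSum _ fun j _ => i i' j]
  simp_rw [integral_finsetSum _ fun j _ => i _ j, e]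
  simp only [← Finset.mul_sum, Finset.sum_add_distrib]
  simp only [sub_self, mul_zero, Finset.sum_const_zero, zero_add]
  rfl

theorem integrable_inner (h : HasMoments μ c m S) (b : Vec d) :
    Integrable (fun x => inner ℝ b (x - m)) μ := by
  simp only [PiLp.inner_apply, PiLp.sub_apply]
  exact integrable_finsetSum _ fun i _ => (h.integrable i).mul_const _

theorem integral_inner (h : HasMoments μ c m S) (b : Vec d) :
    ∫ x, inner ℝ b (x - m) ∂μ = 0 := by
  simp only [PiLp.inner_apply, PiLp.sub_apply, RCLike.inner_apply, conj_trivial]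
  rw [integral_finsetSum _ fun i _ => (h.integrable i).mul_const _]
  refine Finset.sum_eq_zero fun i _ => ?_
  rw [integral_mul_const, h.mean, zero_mul]

end HasMoments

theorem hasMoments_gaussian {c : ℝ} (hc : 0 < c) (m : Vec d) {S : Mat d} (hS : S.PosSemidef) :
    HasMoments (gaussian c m S) c m S := by
  have hL2 : ∀ i, MemLp (fun x : Vec d => x i - m i) 2 (multivariateGaussian m S) := fun i => by
    refine MemLp.sub ?_ (memLp_const _)
    exact (IsGaussian.memLp_two_id (μ := multivariateGaussian m S)).continuousLinearMap_comp
      (EuclideanSpace.proj i : Vec d →L[ℝ] ℝ)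
  have hmean : ∀ i, ∫ x : Vec d, x i ∂(multivariateGaussian m S) = m i := fun i => by
    have := (EuclideanSpace.proj i : Vec d →L[ℝ] ℝ).integral_comp_comm
      (IsGaussian.integrable_id (μ := multivariateGaussian m S))
    simpa using this
  have hint : ∀ i, Integrable (fun x : Vec d => x i) (multivariateGaussian m S) := fun i =>
    (EuclideanSpace.proj i : Vec d →L[ℝ] ℝ).integrable_comp
      (IsGaussian.integrable_id (μ := multivariateGaussian m S))
  refine ⟨?_, ?_, fun i => ?_, fun i j => ?_, fun i => ?_, fun i j => ?_⟩
  · exact Measure.smul_finite _ ENNReal.ofReal_ne_top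
  · simp [gaussian, hc.le]
  · exact ((hL2 i).integrable (by norm_num)).smul_measure ENNReal.ofReal_ne_top
  · exact ((hL2 i).integrable_mul (hL2 j)).smul_measure ENNReal.ofReal_ne_top
  · rw [gaussian, integral_smul_measure, integral_sub (hint i) (integrable_const _), hmean]
    simp
  · rw [gaussian, integral_smul_measure, ENNReal.toReal_ofReal hc.le, smul_eq_mul]
    congr 1
    rw [← covariance_eval_multivariateGaussian (μ := m) hS i j, covariance, hmean, hmean]

/-- A measure with finite second moment and positive mass has a mean and a covariance. -/
theorem exists_hasMoments {μ : Measure (Vec d)} (hμ : μ ∈ finiteMoment 2 (Vec d))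
    (h0 : μ ≠ 0) : ∃ m S, S.PosSemidef ∧ HasMoments μ (μ.real Set.univ) m S := by
  obtain ⟨hf, h2⟩ := hμ
  have hL2 : ∀ i, MemLp (fun x : Vec d => x i) 2 μ := fun i => by
    have : MemLp (id : Vec d → Vec d) 2 μ := by
      refine ⟨by fun_prop, ?_⟩
      rw [eLpNorm_lt_top_iff_lintegral_rpow_enorm_lt_top (by norm_num) (by norm_num)]
      simpa using h2
    exact this.continuousLinearMap_comp
      (EuclideanSpace.proj i : Vec d →L[ℝ] ℝ)
  have hc : μ.real Set.univ ≠ 0 := by simpa [measureReal_eq_zero_iff] using h0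
  have hcp : 0 ≤ μ.real Set.univ := measureReal_nonneg
  set c := μ.real Set.univ with hcdef
  let m : Vec d := WithLp.toLp 2 fun i => c⁻¹ * ∫ x : Vec d, x i ∂μ
  have hL2' : ∀ i, MemLp (fun x : Vec d => x i - m i) 2 μ := fun i => (hL2 i).sub (memLp_const _)
  let S : Mat d := Matrix.of fun i j => c⁻¹ * ∫ x : Vec d, (x i - m i) * (x j - m j) ∂μ
  refine ⟨m, S, ?_, hf, rfl, fun i => (hL2' i).integrable (by norm_num),
    fun i j => (hL2' i).integrable_mul (hL2' j), fun i => ?_, fun i j => ?_⟩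
  · refine Matrix.PosSemidef.of_dotProduct_mulVec_nonneg ?_ fun v => ?_
    · ext i j
      simp [S, mul_comm]
    · have hi : ∀ i j, Integrable (fun x : Vec d => v i * ((x i - m i) * (x j - m j) * v j)) μ :=
        fun i j => (((hL2' i).integrable_mul (hL2' j)).mul_const _).const_mul _
      -- The quadratic form of a covariance is the variance of a linear functional.
      have : star v ⬝ᵥ S *ᵥ v = c⁻¹ * ∫ x : Vec d, (∑ i, v i * (x i - m i)) ^ 2 ∂μ := by
        have hsq : ∀ x : Vec d, (∑ i, v i * (x i - m i)) ^ 2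
            = ∑ i, ∑ j, v i * ((x i - m i) * (x j - m j) * v j) := fun x => by
          rw [sq, Finset.sum_mul_sum]
          refine Finset.sum_congr rfl fun i _ => Finset.sum_congr rfl fun j _ => ?_
          ring
        simp_rw [hsq]
        rw [integral_finsetSum _ fun i _ => integrable_finsetSum _ fun j _ => hi i j]
        simp_rw [integral_finsetSum _ fun j _ => hi _ j, integral_const_mul, integral_mul_const]
        simp only [star_trivial, dotProduct, Matrix.mulVec, S, Matrix.of_apply, Finset.mul_sum]
        refine Finset.sum_congr rfl fun i _ => Finset.sum_congr rfl fun j _ => ?_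
        ring
      rw [this]
      exact mul_nonneg (inv_nonneg.2 hcp) (integral_nonneg fun x => sq_nonneg _)
  · rw [integral_sub ((hL2 i).integrable (by norm_num)) (integrable_const _), integral_const,
      ← hcdef, smul_eq_mul]
    simp only [m]
    rw [mul_inv_cancel_left₀ hc, sub_self]
  · simp only [S, Matrix.of_apply]
    rw [mul_inv_cancel_left₀ hc]

/-- The covariance of a measure with a density is nondegenerate. -/
theorem HasMoments.posDef {μ : Measure (Vec d)} {c : ℝ} {m : Vec d} {S : Mat d}
    (h : HasMoments μ c m S) (hc : 0 < c) (hS : S.PosSemidef) (hμ : μ ≪ volume) : S.PosDef := by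
  refine Matrix.PosDef.of_dotProduct_mulVec_pos hS.isHermitian fun v hv => ?_
  refine (hS.dotProduct_mulVec_nonneg v).lt_of_ne fun h0 => ?_
  have hi := h.integrable_quad (Matrix.vecMulVec v v) m
  have hq : ∀ x : Vec d, quad (Matrix.vecMulVec v v) (x - m) = (v ⬝ᵥ (x - m).ofLp) ^ 2 := fun x => by
    rw [quad, Matrix.vecMulVec_mulVec, sq]
    simp only [dotProduct_smul, smul_eq_mul, op_smul_eq_smul]
    rw [dotProduct_comm]
  have hint := h.integral_quad hS.isHermitian (Matrix.vecMulVec v v) m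
  have htr : (Matrix.vecMulVec v v * S).trace = 0 := by
    rw [Matrix.trace_mul_comm, Matrix.mul_vecMulVec, Matrix.trace_vecMulVec, dotProduct_comm]
    rw [star_trivial] at h0
    exact h0.symm
  have hz : quad (Matrix.vecMulVec v v) (m - m) = 0 := by simp [quad]
  rw [htr, hz, add_zero, mul_zero, integral_eq_zero_iff_of_nonneg
    (fun x => by rw [hq]; exact sq_nonneg _) hi] at hint
  -- A null direction `v` of the covariance would confine `μ` to the hyperplane through `m`
  -- orthogonal to `v`, which is Lebesgue null.
  let s : AffineSubspace ℝ (Vec d) := AffineSubspace.mk' m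
    (LinearMap.ker (innerSL ℝ (WithLp.toLp 2 v : Vec d)).toLinearMap)
  have hs : volume (s : Set (Vec d)) = 0 := by
    refine Measure.addHaar_affineSubspace _ s fun htop => hv ?_
    have hmem : m + WithLp.toLp 2 v ∈ s := htop ▸ AffineSubspace.mem_top ℝ _ _
    rw [AffineSubspace.mem_mk'] at hmem
    simpa using hmem
  have hsub : ∀ᵐ x ∂μ, x ∈ (s : Set (Vec d)) := by
    filter_upwards [hint] with x hx
    rw [hq] at hx
    have hx' := pow_eq_zero_iff (two_ne_zero) |>.1 hx
    rw [SetLike.mem_coe, AffineSubspace.mem_mk']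
    simp only [vsub_eq_sub, LinearMap.mem_ker, ContinuousLinearMap.coe_coe, innerSL_apply_apply,
      PiLp.inner_apply]
    rw [← hx']
    simp [dotProduct, mul_comm]
  have hzero : μ Set.univ = 0 := by
    have h1 : μ (s : Set (Vec d))ᶜ = 0 := hsub
    have h2 : μ (s : Set (Vec d)) = 0 := hμ hs
    refine measure_mono_null (fun x _ => ?_) (measure_union_null h2 h1)
    exact em _
  have := h.mass
  rw [measureReal_def, hzero] at this
  simp at this
  exact hc.ne this

/-! ### Relative entropy with respect to a Gaussian -/

instance isFiniteMeasure_gaussian (c : ℝ) (m : Vec d) (S : Mat d) :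
    IsFiniteMeasure (gaussian c m S) := Measure.smul_finite _ ENNReal.ofReal_ne_top

theorem Ref.isFiniteMeasure_measure (ν : Ref d) : IsFiniteMeasure ν.measure :=
  isFiniteMeasure_gaussian _ _ _

theorem measureReal_univ_gaussian {c : ℝ} (hc : 0 ≤ c) (m : Vec d) (S : Mat d) :
    (gaussian c m S).real Set.univ = c := by
  simp [gaussian, hc]

theorem measurable_exp_logDensity (m : Vec d) (S : Mat d) :
    Measurable fun x : Vec d => ENNReal.ofReal (Real.exp (logDensity m S x)) :=
  ((continuous_logDensity m S).rexp.measurable).ennreal_ofReal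

theorem multivariateGaussian_absolutelyContinuous (m : Vec d) {S : Mat d} (hS : S.PosDef) :
    multivariateGaussian m S ≪ volume := by
  rw [multivariateGaussian_eq_withDensity m hS]
  exact withDensity_absolutelyContinuous _ _

theorem gaussian_absolutelyContinuous (c : ℝ) (m : Vec d) {S : Mat d} (hS : S.PosDef) :
    gaussian c m S ≪ volume :=
  (multivariateGaussian_absolutelyContinuous m hS).smul_left _

/-- The logarithm of the density of `ν` with mean `m`, covariance `Σ` and mass `c` relative to a
reference Gaussian. -/
noncomputable def logRelDensity (ν : Ref d) (c : ℝ) (m : Vec d) (S : Mat d) (x : Vec d) : ℝ :=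
  Real.log (c / ν.mass) + logDensity m S x - logDensity ν.mean ν.cov x

theorem continuous_logRelDensity (ν : Ref d) (c : ℝ) (m : Vec d) (S : Mat d) :
    Continuous (logRelDensity ν c m S) :=
  (continuous_const.add (continuous_logDensity m S)).sub (continuous_logDensity _ _)

theorem gaussian_eq_withDensity {ν : Ref d} (hν : ν.Nondegenerate) {c : ℝ} (hc : 0 < c)
    (m : Vec d) {S : Mat d} (hS : S.PosDef) :
    gaussian c m S = ν.measure.withDensity fun x =>
      ENNReal.ofReal (Real.exp (logRelDensity ν c m S x)) := by
  have hm : Measurable fun x => ENNReal.ofReal (Real.exp (logRelDensity ν c m S x)) :=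
    ((continuous_logRelDensity ν c m S).rexp.measurable).ennreal_ofReal
  rw [Ref.measure, gaussian, gaussian, multivariateGaussian_eq_withDensity m hS,
    multivariateGaussian_eq_withDensity _ hν.cov_posDef, withDensity_smul_measure,
    ← withDensity_mul _ (measurable_exp_logDensity _ _) hm,
    ← withDensity_smul' _ _ ENNReal.ofReal_ne_top, ← withDensity_smul' _ _ ENNReal.ofReal_ne_top]
  congr 1
  ext x
  simp only [Pi.smul_apply, Pi.mul_apply, smul_eq_mul]
  rw [← ENNReal.ofReal_mul hc.le, ← ENNReal.ofReal_mul (Real.exp_pos _).le,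
    ← ENNReal.ofReal_mul hν.mass_pos.le, logRelDensity, Real.exp_sub, Real.exp_add,
    Real.exp_log (div_pos hc hν.mass_pos)]
  congr 1
  have := hν.mass_pos.ne'
  have := (Real.exp_pos (logDensity ν.mean ν.cov x)).ne'
  field_simp

theorem measure_absolutelyContinuous_gaussian {ν : Ref d} (hν : ν.Nondegenerate) {c : ℝ}
    (hc : 0 < c) (m : Vec d) {S : Mat d} (hS : S.PosDef) : ν.measure ≪ gaussian c m S := by
  rw [gaussian_eq_withDensity hν hc m hS]
  refine withDensity_absolutelyContinuous' ?_ ?_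
  · exact ((continuous_logRelDensity ν c m S).rexp.measurable).ennreal_ofReal.aemeasurable
  · exact Filter.Eventually.of_forall fun x => (ENNReal.ofReal_pos.2 (Real.exp_pos _)).ne'

theorem gaussian_absolutelyContinuous_measure {ν : Ref d} (hν : ν.Nondegenerate) {c : ℝ}
    (hc : 0 < c) (m : Vec d) {S : Mat d} (hS : S.PosDef) : gaussian c m S ≪ ν.measure := by
  rw [gaussian_eq_withDensity hν hc m hS]
  exact withDensity_absolutelyContinuous _ _

theorem llr_gaussian {ν : Ref d} (hν : ν.Nondegenerate) {c : ℝ} (hc : 0 < c)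
    (m : Vec d) {S : Mat d} (hS : S.PosDef) :
    llr (gaussian c m S) ν.measure =ᵐ[ν.measure] logRelDensity ν c m S := by
  have := ν.isFiniteMeasure_measure
  have h := Measure.rnDeriv_withDensity ν.measure
    (((continuous_logRelDensity ν c m S).rexp.measurable).ennreal_ofReal)
  rw [← gaussian_eq_withDensity hν hc m hS] at h
  filter_upwards [h] with x hx
  rw [llr, hx, ENNReal.toReal_ofReal (Real.exp_pos _).le, Real.log_exp]

/-- The divergence of `c N(m, Σ)` from a reference Gaussian. -/
noncomputable def gaussianDiv (ν : Ref d) (c : ℝ) (m : Vec d) (S : Mat d) : ℝ :=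
  c * (1 / 2 * (ν.cov⁻¹ * S).trace + 1 / 2 * quad ν.cov⁻¹ (m - ν.mean)
    + 1 / 2 * Real.log ν.cov.det - 1 / 2 * Real.log S.det - d / 2) + phi ν c

theorem HasMoments.integrable_logRelDensity {μ : Measure (Vec d)} {c : ℝ} {m : Vec d} {S : Mat d}
    (h : HasMoments μ c m S) (ν : Ref d) (b : ℝ) (R : Mat d) :
    Integrable (logRelDensity ν b m R) μ := by
  have := h.finite
  unfold logRelDensity logDensity
  have h1 := h.integrable_quad R⁻¹ m
  have h2 := h.integrable_quad ν.cov⁻¹ ν.mean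
  fun_prop

/-- The integrand is quadratic, so every measure with these moments gives the same value as the
Gaussian. -/
theorem HasMoments.integral_logRelDensity {μ : Measure (Vec d)} {c : ℝ} {m : Vec d} {S : Mat d}
    (h : HasMoments μ c m S) (hS : S.PosDef) (ν : Ref d) :
    ∫ x, logRelDensity ν c m S x ∂μ = gaussianDiv ν c m S - ν.mass + c := by
  have := h.finite
  have h1 := h.integrable_quad S⁻¹ m
  have h2 := h.integrable_quad ν.cov⁻¹ ν.mean
  have he : ∀ x, logRelDensity ν c m S x = (Real.log (c / ν.mass) - 1 / 2 * Real.log S.det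
      + 1 / 2 * Real.log ν.cov.det) + (1 / 2 * quad ν.cov⁻¹ (x - ν.mean)
      - 1 / 2 * quad S⁻¹ (x - m)) := fun x => by
    rw [logRelDensity, logDensity, logDensity]; ring
  simp_rw [he]
  have h12 : Integrable (fun x => 1 / 2 * quad ν.cov⁻¹ (x - ν.mean)
      - 1 / 2 * quad S⁻¹ (x - m)) μ := (h2.const_mul _).sub (h1.const_mul _)
  rw [integral_add (integrable_const _) h12,
    integral_sub (h2.const_mul _) (h1.const_mul _), integral_const_mul, integral_const_mul,
    h.integral_quad hS.isHermitian, h.integral_quad hS.isHermitian, integral_const, h.mass,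
    Matrix.nonsing_inv_mul _ ((Matrix.isUnit_iff_isUnit_det _).1 hS.isUnit), gaussianDiv, phi]
  have hz : quad S⁻¹ (m - m) = 0 := by simp [quad]
  rw [hz]
  simp
  ring

theorem klDiv_gaussian {ν : Ref d} (hν : ν.Nondegenerate) {c : ℝ} (hc : 0 < c)
    (m : Vec d) {S : Mat d} (hS : S.PosDef) :
    klDiv (gaussian c m S) ν.measure ≠ ⊤ ∧
      (klDiv (gaussian c m S) ν.measure).toReal = gaussianDiv ν c m S := by
  have := ν.isFiniteMeasure_measure
  have hac := gaussian_absolutelyContinuous_measure hν hc m hS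
  have hM := hasMoments_gaussian hc m hS.posSemidef
  have hllr : _ =ᵐ[gaussian c m S] _ := hac.ae_le (llr_gaussian hν hc m hS)
  have hint := (hM.integrable_logRelDensity ν c S).congr hllr.symm
  refine ⟨klDiv_ne_top hac hint, ?_⟩
  rw [toReal_klDiv hac hint, integral_congr_ae hllr, hM.integral_logRelDensity hS, hM.mass,
    Ref.measure, measureReal_univ_gaussian hν.mass_pos.le]
  ring

theorem rnDeriv_toReal_pos {X : Type*} [MeasurableSpace X] {μ ν : Measure X} [SigmaFinite μ]
    [SigmaFinite ν] (h : μ ≪ ν) : ∀ᵐ x ∂μ, 0 < (μ.rnDeriv ν x).toReal := by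
  filter_upwards [Measure.rnDeriv_pos h, h.ae_le (Measure.rnDeriv_lt_top μ ν)] with x h1 h2
  exact ENNReal.toReal_pos h1.ne' h2.ne

/-- Among the measures with given mass, mean and covariance, the Gaussian minimizes the divergence
from a reference Gaussian. -/
theorem HasMoments.gaussianDiv_le_klDiv {ν : Ref d} (hν : ν.Nondegenerate) {μ : Measure (Vec d)}
    {c : ℝ} {m : Vec d} {S : Mat d} (h : HasMoments μ c m S) (hc : 0 < c) (hS : S.PosDef)
    (hkl : klDiv μ ν.measure ≠ ⊤) : gaussianDiv ν c m S ≤ (klDiv μ ν.measure).toReal := by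
  have := ν.isFiniteMeasure_measure
  have := h.finite
  obtain ⟨hac, hint⟩ := klDiv_ne_top_iff.1 hkl
  have hνN := measure_absolutelyContinuous_gaussian hν hc m hS
  have hNν := gaussian_absolutelyContinuous_measure hν hc m hS
  have hμN : μ ≪ gaussian c m S := hac.trans hνN
  -- Chain rule for densities through the Gaussian with the moments of `μ`.
  have hsum : llr μ (gaussian c m S)
      =ᵐ[μ] fun x => llr μ ν.measure x - logRelDensity ν c m S x := by
    have h1 := hac.ae_le (Measure.rnDeriv_mul_rnDeriv (κ := ν.measure) hμN)
    have h2 := hac.ae_le (llr_gaussian hν hc m hS)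
    have h3 := rnDeriv_toReal_pos hμN
    have h4 := hμN.ae_le (rnDeriv_toReal_pos hNν)
    filter_upwards [h1, h2, h3, h4] with x h1 h2 h3 h4
    rw [← h2, llr, llr, llr, ← h1, Pi.mul_apply, ENNReal.toReal_mul,
      Real.log_mul h3.ne' h4.ne']
    ring
  have hlog := h.integrable_logRelDensity ν c S
  have hint' : Integrable (llr μ (gaussian c m S)) μ := (hint.sub hlog).congr hsum.symm
  -- The divergence of `μ` from that Gaussian is nonnegative; the two masses agree and cancel.
  have h0 := integral_llr_add_sub_measure_univ_nonneg hμN hint'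
  rw [integral_congr_ae hsum, integral_sub hint hlog, h.integral_logRelDensity hS, h.mass,
    measureReal_univ_gaussian hc.le] at h0
  rw [toReal_klDiv hac hint, h.mass, Ref.measure, measureReal_univ_gaussian hν.mass_pos.le]
  rw [Ref.measure] at h0
  linarith

/-! ### The lower bound for the transport cost -/

theorem quad_inv_sub_mulVec {T : Mat d} (hT : T.PosDef) (u v : Vec d) :
    quad T⁻¹ (v - Matrix.toEuclideanLin T u) = quad T⁻¹ v - 2 * inner ℝ u v + quad T u := by
  have hTu := (Matrix.isUnit_iff_isUnit_det _).1 hT.isUnit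
  have hTt : Tᵀ = T := hT.isHermitian.eq
  have h1 : T⁻¹ *ᵥ (T *ᵥ u.ofLp) = u.ofLp := by
    rw [Matrix.mulVec_mulVec, Matrix.nonsing_inv_mul _ hTu, Matrix.one_mulVec]
  have h2 : (T *ᵥ u.ofLp) ⬝ᵥ (T⁻¹ *ᵥ v.ofLp) = u.ofLp ⬝ᵥ v.ofLp := by
    conv_lhs => rw [← hTt]
    rw [Matrix.mulVec_transpose, hTt, ← Matrix.dotProduct_mulVec, Matrix.mulVec_mulVec,
      Matrix.mul_nonsing_inv _ hTu, Matrix.one_mulVec]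
  have h3 : inner ℝ u v = u.ofLp ⬝ᵥ v.ofLp := by
    simp [PiLp.inner_apply, dotProduct, mul_comm]
  rw [h3]
  simp only [quad, WithLp.ofLp_sub, Matrix.ofLp_toLpLin, Matrix.toLin'_apply, Matrix.mulVec_sub,
    dotProduct_sub, sub_dotProduct, h1, h2, dotProduct_comm v.ofLp u.ofLp,
    dotProduct_comm (T *ᵥ u.ofLp) u.ofLp]
  ring

/-- The sum of the quadratic dual potentials attached to the moments `q`. -/
noncomputable def dualPotential (q : Moments d) (x : Vec d × Vec d) : ℝ :=
  (‖q.2.2.1 - q.1‖ ^ 2 + quad (1 - transportMatrix q.2.1 q.2.2.2) (x.1 - q.1)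
    - 2 * inner ℝ (q.2.2.1 - q.1) (x.1 - q.1))
  + (quad (1 - (transportMatrix q.2.1 q.2.2.2)⁻¹) (x.2 - q.2.2.1)
    + 2 * inner ℝ (q.2.2.1 - q.1) (x.2 - q.2.2.1))

/-- The duality gap is a complete square. It is nonnegative, so the potentials are feasible, and it
vanishes exactly on the graph of the transport map. -/
theorem norm_sub_sq_eq_dualPotential_add {q : Moments d} (hq : q ∈ momentDomain d)
    (x : Vec d × Vec d) :
    ‖x.2 - x.1‖ ^ 2 = dualPotential q x + quad (transportMatrix q.2.1 q.2.2.2)⁻¹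
      (x.2 - q.2.2.1 - Matrix.toEuclideanLin (transportMatrix q.2.1 q.2.2.2) (x.1 - q.1)) := by
  rw [quad_inv_sub_mulVec (posDef_transportMatrix hq.1 hq.2), dualPotential, quad_sub_left,
    quad_sub_left, quad_one, quad_one]
  have : x.2 - x.1 = (q.2.2.1 - q.1) + ((x.2 - q.2.2.1) - (x.1 - q.1)) := by abel
  rw [this, norm_add_sq_real, norm_sub_sq_real (x.2 - q.2.2.1), inner_sub_right,
    real_inner_comm (x.1 - q.1) (x.2 - q.2.2.1)]
  ring

/-- The squared Gelbrich distance between the moments. -/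
noncomputable def gelbrich (q : Moments d) : ℝ :=
  ‖q.2.2.1 - q.1‖ ^ 2 + q.2.1.trace + q.2.2.2.trace - 2 * fidelity q.2.1 q.2.2.2

/-- Regrouping by origin, into one transport term and two divergences, matches the objective with
`uotCost`. -/
theorem finObjective_eq_gelbrich_add (γ : ℝ) (α β : Ref d) (z : ℝ × Moments d) :
    finObjective γ α β z = z.1 * gelbrich z.2 + γ * gaussianDiv α z.1 z.2.1 z.2.2.1
      + γ * gaussianDiv β z.1 z.2.2.2.1 z.2.2.2.2 := by
  rw [finObjective, gelbrich, gaussianDiv, gaussianDiv, meanCost, covCost, psi, logDetConst,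
    ← fidelity]
  ring

section Marginals

variable {π : Measure (Vec d × Vec d)} {c : ℝ} {q : Moments d}

theorem integrable_dualPotential (h₁ : HasMoments π.fst c q.1 q.2.1)
    (h₂ : HasMoments π.snd c q.2.2.1 q.2.2.2) : Integrable (dualPotential q) π := by
  have := h₁.finite
  refine Integrable.add (f := fun x : Vec d × Vec d => _) (g := fun x : Vec d × Vec d => _)
    (Integrable.comp_measurable (μ := π) (f := Prod.fst)
      (g := fun y : Vec d => ‖q.2.2.1 - q.1‖ ^ 2
        + quad (1 - transportMatrix q.2.1 q.2.2.2) (y - q.1)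
        - 2 * inner ℝ (q.2.2.1 - q.1) (y - q.1)) ?_ measurable_fst)
    (Integrable.comp_measurable (μ := π) (f := Prod.snd)
      (g := fun y : Vec d => quad (1 - (transportMatrix q.2.1 q.2.2.2)⁻¹) (y - q.2.2.1)
        + 2 * inner ℝ (q.2.2.1 - q.1) (y - q.2.2.1)) ?_ measurable_snd)
  · exact ((integrable_const _).add (h₁.integrable_quad _ _)).sub
      ((h₁.integrable_inner _).const_mul _)
  · exact (h₂.integrable_quad _ _).add ((h₂.integrable_inner _).const_mul _)

/-- Each potential is quadratic in one variable, so only marginal moments enter; `Tr (T Σ₁)` and `Tr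
(T⁻¹ Σ₂)` both equal the fidelity. -/
theorem integral_dualPotential (hq : q ∈ momentDomain d) (h₁ : HasMoments π.fst c q.1 q.2.1)
    (h₂ : HasMoments π.snd c q.2.2.1 q.2.2.2) :
    ∫ x, dualPotential q x ∂π = c * gelbrich q := by
  have := h₁.finite
  have i₁ : Integrable (fun y : Vec d => ‖q.2.2.1 - q.1‖ ^ 2
      + quad (1 - transportMatrix q.2.1 q.2.2.2) (y - q.1)) π.fst :=
    (integrable_const _).add (h₁.integrable_quad _ _)
  have i₂ := (h₁.integrable_inner (q.2.2.1 - q.1)).const_mul 2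
  have i₃ := h₂.integrable_quad (1 - (transportMatrix q.2.1 q.2.2.2)⁻¹) q.2.2.1
  have i₄ := (h₂.integrable_inner (q.2.2.1 - q.1)).const_mul 2
  have i₁₂ : Integrable (fun y : Vec d => ‖q.2.2.1 - q.1‖ ^ 2
      + quad (1 - transportMatrix q.2.1 q.2.2.2) (y - q.1)
      - 2 * inner ℝ (q.2.2.1 - q.1) (y - q.1)) π.fst := i₁.sub i₂
  have i₃₄ : Integrable (fun y : Vec d =>
      quad (1 - (transportMatrix q.2.1 q.2.2.2)⁻¹) (y - q.2.2.1)
      + 2 * inner ℝ (q.2.2.1 - q.1) (y - q.2.2.1)) π.snd := i₃.add i₄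
  have e₁ : ∫ x, ‖q.2.2.1 - q.1‖ ^ 2
      + quad (1 - transportMatrix q.2.1 q.2.2.2) (x.1 - q.1)
      - 2 * inner ℝ (q.2.2.1 - q.1) (x.1 - q.1) ∂π = _ :=
    (integral_map measurable_fst.aemeasurable i₁₂.aestronglyMeasurable).symm
  have e₂ : ∫ x, quad (1 - (transportMatrix q.2.1 q.2.2.2)⁻¹) (x.2 - q.2.2.1)
      + 2 * inner ℝ (q.2.2.1 - q.1) (x.2 - q.2.2.1) ∂π = _ :=
    (integral_map measurable_snd.aemeasurable i₃₄.aestronglyMeasurable).symm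
  have e := integral_add (μ := π) (i₁₂.comp_measurable measurable_fst)
    (i₃₄.comp_measurable measurable_snd)
  simp only [Function.comp_def] at e
  unfold dualPotential
  rw [e, e₁, e₂]
  change ∫ y, _ ∂π.fst + ∫ y, _ ∂π.snd = _
  have hz : ∀ (A : Mat d) (m : Vec d), quad A (m - m) = 0 := fun A m => by simp [quad]
  rw [integral_sub i₁ i₂, integral_add (integrable_const _) (h₁.integrable_quad _ _),
    integral_add i₃ i₄, integral_const_mul, integral_const_mul, h₁.integral_inner,
    h₂.integral_inner, h₁.integral_quad hq.1.isHermitian, h₂.integral_quad hq.2.isHermitian,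
    integral_const, h₁.mass, hz, hz, sub_mul, sub_mul, Matrix.trace_sub, Matrix.trace_sub,
    trace_transportMatrix_mul hq.1, trace_transportMatrix_inv_mul hq.1 hq.2, gelbrich]
  simp
  ring

end Marginals

/-! ### Second moments of plans and the global lower bound -/

theorem mem_finiteMoment_iff {X : Type*} [NormedAddCommGroup X] [MeasurableSpace X]
    [OpensMeasurableSpace X] [SecondCountableTopology X] {μ : Measure X} :
    μ ∈ finiteMoment 2 X ↔ IsFiniteMeasure μ ∧ MemLp id 2 μ := by
  refine and_congr_right fun _ => ?_
  rw [MemLp, and_iff_right (by fun_prop),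
    eLpNorm_lt_top_iff_lintegral_rpow_enorm_lt_top (by norm_num) (by norm_num)]
  simp

theorem fst_mem_finiteMoment {π : Measure (Vec d × Vec d)} (hπ : π ∈ plans d) :
    π.fst ∈ finiteMoment 2 (Vec d) := by
  obtain ⟨hf, h⟩ := mem_finiteMoment_iff.1 hπ
  refine mem_finiteMoment_iff.2 ⟨inferInstance, ?_⟩
  rw [Measure.fst, memLp_map_measure_iff (by fun_prop) (by fun_prop)]
  exact h.continuousLinearMap_comp (ContinuousLinearMap.fst ℝ (Vec d) (Vec d))

theorem snd_mem_finiteMoment {π : Measure (Vec d × Vec d)} (hπ : π ∈ plans d) :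
    π.snd ∈ finiteMoment 2 (Vec d) := by
  obtain ⟨hf, h⟩ := mem_finiteMoment_iff.1 hπ
  refine mem_finiteMoment_iff.2 ⟨inferInstance, ?_⟩
  rw [Measure.snd, memLp_map_measure_iff (by fun_prop) (by fun_prop)]
  exact h.continuousLinearMap_comp (ContinuousLinearMap.snd ℝ (Vec d) (Vec d))

theorem mem_plans_of_marginals {π : Measure (Vec d × Vec d)}
    (h₁ : π.fst ∈ finiteMoment 2 (Vec d)) (h₂ : π.snd ∈ finiteMoment 2 (Vec d)) :
    π ∈ plans d := by
  obtain ⟨hf₁, h₁⟩ := mem_finiteMoment_iff.1 h₁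
  obtain ⟨hf₂, h₂⟩ := mem_finiteMoment_iff.1 h₂
  rw [Measure.fst, memLp_map_measure_iff (by fun_prop) (by fun_prop)] at h₁
  rw [Measure.snd, memLp_map_measure_iff (by fun_prop) (by fun_prop)] at h₂
  refine mem_finiteMoment_iff.2 ⟨⟨?_⟩, ?_⟩
  · rw [← Measure.fst_univ]; exact measure_lt_top _ _
  · refine (h₁.norm.add h₂.norm).mono (by fun_prop) (Filter.Eventually.of_forall fun x => ?_)
    simp only [id, Function.comp_apply, Pi.add_apply]
    rw [Real.norm_of_nonneg (by positivity)]
    exact max_le_add_of_nonneg (norm_nonneg _) (norm_nonneg _)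

theorem integrable_norm_sub_sq {π : Measure (Vec d × Vec d)} (hπ : π ∈ plans d) :
    Integrable (fun x : Vec d × Vec d => ‖x.2 - x.1‖ ^ 2) π := by
  obtain ⟨hf, h⟩ := mem_finiteMoment_iff.1 hπ
  exact (h.continuousLinearMap_comp (ContinuousLinearMap.snd ℝ (Vec d) (Vec d)
    - ContinuousLinearMap.fst ℝ (Vec d) (Vec d))).integrable_norm_pow (by norm_num)

theorem lintegral_norm_sub_sq {π : Measure (Vec d × Vec d)} (hπ : π ∈ plans d) :
    ∫⁻ x, ENNReal.ofReal (‖x.2 - x.1‖ ^ 2) ∂π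
      = ENNReal.ofReal (∫ x, ‖x.2 - x.1‖ ^ 2 ∂π) :=
  (ofReal_integral_eq_lintegral_ofReal (integrable_norm_sub_sq hπ)
    (Filter.Eventually.of_forall fun _ => by positivity)).symm

theorem mul_gelbrich_le {π : Measure (Vec d × Vec d)} {c : ℝ} {q : Moments d} (hπ : π ∈ plans d)
    (hq : q ∈ momentDomain d) (h₁ : HasMoments π.fst c q.1 q.2.1)
    (h₂ : HasMoments π.snd c q.2.2.1 q.2.2.2) :
    c * gelbrich q ≤ ∫ x, ‖x.2 - x.1‖ ^ 2 ∂π := by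
  rw [← integral_dualPotential hq h₁ h₂]
  refine integral_mono (integrable_dualPotential h₁ h₂) (integrable_norm_sub_sq hπ) fun x => ?_
  dsimp only
  rw [norm_sub_sq_eq_dualPotential_add hq]
  have := quad_nonneg (posDef_transportMatrix hq.1 hq.2).inv.posSemidef
    (x.2 - q.2.2.1 - Matrix.toEuclideanLin (transportMatrix q.2.1 q.2.2.2) (x.1 - q.1))
  linarith

theorem IsOutput.le_uotCost {γ : ℝ} (hγ : 0 < γ) {α β : Ref d} (hα : α.Nondegenerate)
    (hβ : β.Nondegenerate) {q : Moments d} {p c : ℝ} (h : IsOutput γ α β q p c)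
    {π : Measure (Vec d × Vec d)} (hπ : π ∈ plans d) :
    ENNReal.ofReal (c * p + psi γ α β c) ≤ uotCost γ α β π := by
  have hγ' : ENNReal.ofReal γ ≠ 0 := (ENNReal.ofReal_pos.2 hγ).ne'
  by_cases htop : uotCost γ α β π = ⊤
  · rw [htop]; exact le_top
  have hf : IsFiniteMeasure π := hπ.1
  have := α.isFiniteMeasure_measure
  have := β.isFiniteMeasure_measure
  have hcost := lintegral_norm_sub_sq hπ
  rw [ENNReal.ofReal_le_iff_le_toReal htop]
  have htop' := htop
  rw [uotCost, ENNReal.add_eq_top, ENNReal.add_eq_top, not_or, not_or] at htop'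
  obtain ⟨⟨-, hα'⟩, hβ'⟩ := htop'
  have hreal : (uotCost γ α β π).toReal = ∫ x, ‖x.2 - x.1‖ ^ 2 ∂π
      + γ * (klDiv π.fst α.measure).toReal + γ * (klDiv π.snd β.measure).toReal := by
    rw [uotCost, hcost, ENNReal.toReal_add (ENNReal.add_ne_top.2 ⟨ENNReal.ofReal_ne_top, hα'⟩) hβ',
      ENNReal.toReal_add ENNReal.ofReal_ne_top hα', ENNReal.toReal_mul, ENNReal.toReal_mul,
      ENNReal.toReal_ofReal hγ.le, ENNReal.toReal_ofReal (integral_nonneg fun _ => by positivity)]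
  have hkα : klDiv π.fst α.measure ≠ ⊤ := fun he => hα' (by rw [he, ENNReal.mul_top hγ'])
  have hkβ : klDiv π.snd β.measure ≠ ⊤ := fun he => hβ' (by rw [he, ENNReal.mul_top hγ'])
  rw [hreal]
  -- The zero plan has no mean or covariance. It costs `γ (c_α + c_β)`, which exceeds the optimum by
  -- `2 γ c`.
  by_cases h0 : π = 0
  · subst h0
    have hc := h.mass_pos hα hβ
    rw [h.massObjective_eq hγ hα hβ hc, div_self hc.ne', klFun_one]
    have hα1 : (α.measure Set.univ).toReal = α.mass := measureReal_univ_gaussian hα.mass_pos.le _ _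
    have hβ1 : (β.measure Set.univ).toReal = β.mass := measureReal_univ_gaussian hβ.mass_pos.le _ _
    rw [Measure.fst_zero, Measure.snd_zero, klDiv_zero_left, klDiv_zero_left, integral_zero_measure,
      hα1, hβ1]
    have := mul_pos hγ hc
    linarith
  · have h0₁ : π.fst ≠ 0 := fun he => h0 (by
      rw [← Measure.measure_univ_eq_zero, ← Measure.fst_univ, he]; simp)
    have h0₂ : π.snd ≠ 0 := fun he => h0 (by
      rw [← Measure.measure_univ_eq_zero, ← Measure.snd_univ, he]; simp)
    obtain ⟨m₁, S₁, hS₁, hM₁⟩ := exists_hasMoments (fst_mem_finiteMoment hπ) h0₁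
    obtain ⟨m₂, S₂, hS₂, hM₂⟩ := exists_hasMoments (snd_mem_finiteMoment hπ) h0₂
    have e₁ : π.fst.real Set.univ = π.real Set.univ := by
      rw [measureReal_def, Measure.fst_univ, measureReal_def]
    have e₂ : π.snd.real Set.univ = π.real Set.univ := by
      rw [measureReal_def, Measure.snd_univ, measureReal_def]
    rw [e₁] at hM₁
    rw [e₂] at hM₂
    have hc : 0 < π.real Set.univ := by
      have : NeZero π := ⟨h0⟩
      exact measureReal_univ_pos
    -- Finite divergence from a nondegenerate Gaussian gives the marginal a density, so its
    -- covariance lies in the domain of the subproblem.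
    have hPD₁ := hM₁.posDef hc hS₁
      ((klDiv_ne_top_iff.1 hkα).1.trans (gaussian_absolutelyContinuous _ _ hα.cov_posDef))
    have hPD₂ := hM₂.posDef hc hS₂
      ((klDiv_ne_top_iff.1 hkβ).1.trans (gaussian_absolutelyContinuous _ _ hβ.cov_posDef))
    have hfin := h.le_finObjective hγ hα hβ
      (z := (π.real Set.univ, m₁, S₁, m₂, S₂)) ⟨hc, hPD₁, hPD₂⟩
    rw [finObjective_eq_gelbrich_add] at hfin
    have g₀ := mul_gelbrich_le (q := (m₁, S₁, m₂, S₂)) hπ ⟨hPD₁, hPD₂⟩ hM₁ hM₂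
    have g₁ := mul_le_mul_of_nonneg_left (hM₁.gaussianDiv_le_klDiv hα hc hPD₁ hkα) hγ.le
    have g₂ := mul_le_mul_of_nonneg_left (hM₂.gaussianDiv_le_klDiv hβ hc hPD₂ hkβ) hγ.le
    dsimp only at hfin
    linarith

/-! ### Gaussian plans and their absolutely continuous perturbations -/

/-- The map `(x, z) ↦ (x, m₂ + cos θ T (x - m₁) + sin θ z)`. -/
noncomputable def rotationMap (θ : ℝ) (q : Moments d) (x : Vec d × Vec d) : Vec d × Vec d :=
  (x.1, q.2.2.1 + Real.cos θ •
    Matrix.toEuclideanLin (transportMatrix q.2.1 q.2.2.2) (x.1 - q.1) + Real.sin θ • x.2)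

theorem continuous_toEuclideanLin (A : Mat d) : Continuous (Matrix.toEuclideanLin A) :=
  LinearMap.continuous_of_finiteDimensional _

theorem continuous_rotationMap (θ : ℝ) (q : Moments d) : Continuous (rotationMap θ q) := by
  have := continuous_toEuclideanLin (transportMatrix q.2.1 q.2.2.2)
  unfold rotationMap
  fun_prop

/-- The joint law `N(m₁, Σ₁) ⊗ N(0, Σ₂)` of the source and the noise. -/
noncomputable def noiseLaw (q : Moments d) : Measure (Vec d × Vec d) :=
  (multivariateGaussian q.1 q.2.1).prod (multivariateGaussian 0 q.2.2.2)

instance (q : Moments d) : IsProbabilityMeasure (noiseLaw q) := by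
  unfold noiseLaw; infer_instance

/-- A Gaussian plan whose coupling is weakened by the angle `θ`. -/
noncomputable def rotatedPlan (θ c : ℝ) (q : Moments d) : Measure (Vec d × Vec d) :=
  ENNReal.ofReal c • (noiseLaw q).map (rotationMap θ q)

theorem rotatedPlan_fst (θ c : ℝ) (q : Moments d) :
    (rotatedPlan θ c q).fst = gaussian c q.1 q.2.1 := by
  rw [rotatedPlan, Measure.fst, Measure.map_smul,
    Measure.map_map measurable_fst (continuous_rotationMap θ q).measurable]
  change _ • Measure.map Prod.fst (noiseLaw q) = _
  rw [noiseLaw, gaussian, ← Measure.fst, Measure.fst_prod]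

theorem inner_toEuclideanLin_left {T : Mat d} (hT : T.IsHermitian) (x y : Vec d) :
    inner ℝ (Matrix.toEuclideanLin T x) y = inner ℝ x (Matrix.toEuclideanLin T y) :=
  (Matrix.isSymmetric_toEuclideanLin_iff.2 hT) x y

/-- The transported source and the noise are independent with the same covariance `Σ₂`, and `cos² θ
+ sin² θ = 1`. The characteristic function factors accordingly. -/
theorem map_rotation_noiseLaw (θ : ℝ) {q : Moments d} (hq : q ∈ momentDomain d) :
    (noiseLaw q).map (fun x => (rotationMap θ q x).2)
      = multivariateGaussian q.2.2.1 q.2.2.2 := by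
  have hT := posDef_transportMatrix hq.1 hq.2
  have hTS := transportMatrix_mul_mul hq.1 hq.2
  have hcont : Continuous fun x => (rotationMap θ q x).2 :=
    continuous_snd.comp (continuous_rotationMap θ q)
  have : IsProbabilityMeasure ((noiseLaw q).map (fun x => (rotationMap θ q x).2)) :=
    Measure.isProbabilityMeasure_map hcont.measurable.aemeasurable
  apply Measure.ext_of_charFun
  ext t
  rw [charFun_multivariateGaussian hq.2.posSemidef, charFun_apply,
    integral_map hcont.measurable.aemeasurable (by fun_prop)]
  set T := transportMatrix q.2.1 q.2.2.2 with hTdef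
  have hexp : ∀ x : Vec d × Vec d,
      Complex.exp (inner ℝ (rotationMap θ q x).2 t * Complex.I)
      = (Complex.exp (inner ℝ (q.2.2.1 - Real.cos θ • Matrix.toEuclideanLin T q.1) t * Complex.I)
          * Complex.exp (inner ℝ x.1 (Real.cos θ • Matrix.toEuclideanLin T t) * Complex.I))
        * Complex.exp (inner ℝ x.2 (Real.sin θ • t) * Complex.I) := fun x => by
    rw [← Complex.exp_add, ← Complex.exp_add, ← add_mul, ← add_mul, ← Complex.ofReal_add,
      ← Complex.ofReal_add]
    congr 4
    rw [rotationMap, ← hTdef, map_sub]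
    simp only [inner_add_left, inner_sub_left, inner_smul_left, inner_smul_right, smul_sub,
      inner_toEuclideanLin_left hT.isHermitian, conj_trivial]
    ring
  simp_rw [hexp]
  rw [noiseLaw, integral_prod_mul (f := fun x : Vec d => Complex.exp
    (inner ℝ (q.2.2.1 - Real.cos θ • Matrix.toEuclideanLin T q.1) t * Complex.I)
    * Complex.exp (inner ℝ x (Real.cos θ • Matrix.toEuclideanLin T t) * Complex.I))
    (g := fun z : Vec d => Complex.exp (inner ℝ z (Real.sin θ • t) * Complex.I)),
    integral_const_mul, ← charFun_apply, ← charFun_apply,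
    charFun_multivariateGaussian hq.1.posSemidef, charFun_multivariateGaussian hq.2.posSemidef,
    ← Complex.exp_add, ← Complex.exp_add]
  have hquad : (Matrix.toEuclideanLin T t).ofLp ⬝ᵥ q.2.1 *ᵥ (Matrix.toEuclideanLin T t).ofLp
      = t.ofLp ⬝ᵥ q.2.2.2 *ᵥ t.ofLp := by
    have := quad_mulVec q.2.1 T t
    rw [show Tᵀ = T from hT.isHermitian.eq, hTS] at this
    exact this
  congr 1
  simp only [WithLp.ofLp_smul, Matrix.mulVec_smul, smul_dotProduct, dotProduct_smul, smul_eq_mul,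
    hquad, inner_sub_right, inner_smul_left, inner_smul_right, inner_zero_right, conj_trivial,
    inner_toEuclideanLin_left hT.isHermitian, real_inner_comm t]
  have hcs : (Real.sin θ : ℂ) ^ 2 + (Real.cos θ : ℂ) ^ 2 = 1 := by
    exact_mod_cast Real.sin_sq_add_cos_sq θ
  push_cast at hcs ⊢
  linear_combination (-((t.ofLp ⬝ᵥ q.2.2.2 *ᵥ t.ofLp : ℝ) : ℂ) / 2) * hcs

theorem rotatedPlan_snd (θ c : ℝ) {q : Moments d} (hq : q ∈ momentDomain d) :
    (rotatedPlan θ c q).snd = gaussian c q.2.2.1 q.2.2.2 := by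
  rw [rotatedPlan, Measure.snd, Measure.map_smul,
    Measure.map_map measurable_snd (continuous_rotationMap θ q).measurable, gaussian,
    ← map_rotation_noiseLaw θ hq]
  rfl

/-- Lets the Gaussian plan inherit its marginals and admissibility from the rotated family. -/
theorem rotatedPlan_zero (c : ℝ) (q : Moments d) : rotatedPlan 0 c q = gaussianPlan c q := by
  have hT := continuous_toEuclideanLin (transportMatrix q.2.1 q.2.2.2)
  have hm : Measurable fun x => (x, transportMap q x) := by
    unfold transportMap
    exact (by fun_prop : Continuous _).measurable
  rw [rotatedPlan, gaussianPlan, gaussian, Measure.map_smul]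
  congr 1
  have he : rotationMap 0 q = (fun x => (x, transportMap q x)) ∘ Prod.fst := by
    ext1 x
    simp only [rotationMap, Real.cos_zero, one_smul, Real.sin_zero, zero_smul, add_zero,
      Function.comp_apply, transportMap, map_sub]
    congr 1
    abel
  rw [he, ← Measure.map_map hm measurable_fst, noiseLaw, ← Measure.fst, Measure.fst_prod]

theorem gaussian_mem_finiteMoment (c : ℝ) (m : Vec d) (S : Mat d) :
    gaussian c m S ∈ finiteMoment 2 (Vec d) :=
  mem_finiteMoment_iff.2 ⟨inferInstance,
    (IsGaussian.memLp_two_id (μ := multivariateGaussian m S)).smul_measure ENNReal.ofReal_ne_top⟩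

theorem rotatedPlan_mem_plans (θ c : ℝ) {q : Moments d} (hq : q ∈ momentDomain d) :
    rotatedPlan θ c q ∈ plans d :=
  mem_plans_of_marginals (rotatedPlan_fst θ c q ▸ gaussian_mem_finiteMoment _ _ _)
    (rotatedPlan_snd θ c hq ▸ gaussian_mem_finiteMoment _ _ _)

/-- Over each fixed `x` the noise passes through an invertible affine map of factor `sin θ`, so null
fibres stay null; Fubini concludes. -/
theorem rotatedPlan_absolutelyContinuous {θ : ℝ} (hθ : Real.sin θ ≠ 0) (c : ℝ) {q : Moments d}
    (hq : q ∈ momentDomain d) : rotatedPlan θ c q ≪ volume := by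
  refine Measure.AbsolutelyContinuous.smul_left ?_ _
  refine Measure.AbsolutelyContinuous.mk fun s hs h0 => ?_
  have hm := (continuous_rotationMap θ q).measurable
  rw [Measure.map_apply hm hs, noiseLaw, Measure.measure_prod_null (hm hs)]
  rw [Measure.volume_eq_prod, Measure.measure_prod_null hs] at h0
  filter_upwards [(multivariateGaussian_absolutelyContinuous q.1 hq.1).ae_le h0] with x hx
  refine multivariateGaussian_absolutelyContinuous 0 hq.2 ?_
  set a := q.2.2.1 + Real.cos θ •
    Matrix.toEuclideanLin (transportMatrix q.2.1 q.2.2.2) (x - q.1)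
  have he : Prod.mk x ⁻¹' (rotationMap θ q ⁻¹' s)
      = (fun z : Vec d => Real.sin θ • z) ⁻¹' ((fun z => a + z) ⁻¹' (Prod.mk x ⁻¹' s)) := rfl
  rw [he, Measure.addHaar_preimage_smul _ hθ, measure_preimage_add, hx]
  simp

theorem uotCost_rotatedPlan (γ : ℝ) (α β : Ref d) (θ c : ℝ) {q : Moments d}
    (hq : q ∈ momentDomain d) :
    uotCost γ α β (rotatedPlan θ c q)
      = ENNReal.ofReal c * ∫⁻ x, ENNReal.ofReal
          (‖(rotationMap θ q x).2 - (rotationMap θ q x).1‖ ^ 2) ∂(noiseLaw q)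
        + ENNReal.ofReal γ * klDiv (gaussian c q.1 q.2.1) α.measure
        + ENNReal.ofReal γ * klDiv (gaussian c q.2.2.1 q.2.2.2) β.measure := by
  rw [uotCost, rotatedPlan_fst, rotatedPlan_snd θ c hq, rotatedPlan, lintegral_smul_measure,
    lintegral_map (by fun_prop) (continuous_rotationMap θ q).measurable, smul_eq_mul]

/-- A bound for `rotationMap` that is uniform in the angle. -/
noncomputable def rotationBound (q : Moments d) (x : Vec d × Vec d) : ℝ :=
  ‖q.2.2.1‖ + ‖Matrix.toEuclideanLin (transportMatrix q.2.1 q.2.2.2) (x.1 - q.1)‖ + ‖x.2‖ + ‖x.1‖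

theorem norm_rotationMap_sub_le (θ : ℝ) (q : Moments d) (x : Vec d × Vec d) :
    ‖(rotationMap θ q x).2 - (rotationMap θ q x).1‖ ≤ rotationBound q x := by
  simp only [rotationMap, rotationBound]
  refine (norm_sub_le _ _).trans (add_le_add ?_ le_rfl)
  refine (norm_add_le _ _).trans (add_le_add ((norm_add_le _ _).trans (add_le_add le_rfl ?_)) ?_)
  · rw [norm_smul]
    exact mul_le_of_le_one_left (norm_nonneg _) (Real.abs_cos_le_one _)
  · rw [norm_smul]
    exact mul_le_of_le_one_left (norm_nonneg _) (Real.abs_sin_le_one _)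

theorem memLp_rotationBound (q : Moments d) : MemLp (rotationBound q) 2 (noiseLaw q) := by
  have h₁ : MemLp (fun x : Vec d × Vec d => x.1) 2 (noiseLaw q) :=
    (IsGaussian.memLp_two_id (μ := multivariateGaussian q.1 q.2.1)).comp_measurePreserving
      measurePreserving_fst
  have h₂ : MemLp (fun x : Vec d × Vec d => x.2) 2 (noiseLaw q) :=
    (IsGaussian.memLp_two_id (μ := multivariateGaussian 0 q.2.2.2)).comp_measurePreserving
      measurePreserving_snd
  have h₃ : MemLp (fun x : Vec d × Vec d =>
      (Matrix.toEuclideanLin (transportMatrix q.2.1 q.2.2.2)).toContinuousLinearMap (x.1 - q.1))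
      2 (noiseLaw q) :=
    ContinuousLinearMap.comp_memLp' _ (h₁.sub (memLp_const q.1))
  have h₀ : MemLp (fun _ : Vec d × Vec d => ‖q.2.2.1‖) 2 (noiseLaw q) := memLp_const _
  have h₀₃ := h₀.add h₃.norm
  exact (h₀₃.add h₂.norm).add h₁.norm

theorem continuous_rotationMap_angle (q : Moments d) (x : Vec d × Vec d) :
    Continuous fun θ : ℝ => ENNReal.ofReal
      (‖(rotationMap θ q x).2 - (rotationMap θ q x).1‖ ^ 2) := by
  refine ENNReal.continuous_ofReal.comp ?_
  unfold rotationMap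
  fun_prop

/-- Dominated convergence, with the square of `rotationBound` as an integrable majorant independent
of the angle. -/
theorem tendsto_lintegral_rotation (q : Moments d) :
    Filter.Tendsto (fun n : ℕ => ∫⁻ x, ENNReal.ofReal
      (‖(rotationMap (1 / (n + 1)) q x).2 - (rotationMap (1 / (n + 1)) q x).1‖ ^ 2) ∂(noiseLaw q))
      Filter.atTop (nhds (∫⁻ x, ENNReal.ofReal
        (‖(rotationMap 0 q x).2 - (rotationMap 0 q x).1‖ ^ 2) ∂(noiseLaw q))) := by
  refine tendsto_lintegral_of_dominated_convergence
    (fun x => ENNReal.ofReal (rotationBound q x ^ 2))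
    (fun n => ?_) (fun n => Filter.Eventually.of_forall fun x => ?_) ?_
    (Filter.Eventually.of_forall fun x => ?_)
  · have hc := continuous_rotationMap (1 / ((n : ℝ) + 1)) q
    exact (((hc.snd.sub hc.fst).norm.pow 2).measurable).ennreal_ofReal
  · exact ENNReal.ofReal_le_ofReal
      (pow_le_pow_left₀ (norm_nonneg _) (norm_rotationMap_sub_le _ q x) 2)
  · exact (memLp_rotationBound q).integrable_sq.lintegral_lt_top.ne
  · exact ((continuous_rotationMap_angle q x).tendsto 0).comp
      (tendsto_one_div_add_atTop_nhds_zero_nat (𝕜 := ℝ))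

theorem tendsto_uotCost_rotatedPlan (γ : ℝ) (α β : Ref d) (c : ℝ) {q : Moments d}
    (hq : q ∈ momentDomain d) :
    Filter.Tendsto (fun n : ℕ => uotCost γ α β (rotatedPlan (1 / (n + 1)) c q)) Filter.atTop
      (nhds (uotCost γ α β (gaussianPlan c q))) := by
  simp_rw [← rotatedPlan_zero, uotCost_rotatedPlan γ α β _ c hq]
  exact ((ENNReal.Tendsto.const_mul (tendsto_lintegral_rotation q)
    (Or.inr ENNReal.ofReal_ne_top)).add tendsto_const_nhds).add tendsto_const_nhds

/-- The rotated plans with angles `1 / (n + 1)` have densities, since these angles lie in `(0, π)`,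
and their costs converge to that of the Gaussian plan. -/
theorem isGLB_uotCost_acPlans {γ : ℝ} {α β : Ref d} {c : ℝ} {q : Moments d}
    (hq : q ∈ momentDomain d)
    (hmin : ∀ π ∈ plans d, uotCost γ α β (gaussianPlan c q) ≤ uotCost γ α β π) :
    IsGLB (uotCost γ α β '' acPlans d) (uotCost γ α β (gaussianPlan c q)) := by
  refine ⟨Set.forall_mem_image.2 fun π hπ => hmin π hπ.1, fun b hb => ?_⟩
  refine ge_of_tendsto (tendsto_uotCost_rotatedPlan γ α β c hq)
    (Filter.Eventually.of_forall fun n => hb ⟨_, ⟨rotatedPlan_mem_plans _ c hq, ?_⟩, rfl⟩)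
  refine rotatedPlan_absolutelyContinuous (Real.sin_pos_of_pos_of_lt_pi (by positivity) ?_).ne' c hq
  have : 1 / ((n : ℝ) + 1) ≤ 1 := by
    rw [div_le_one (by positivity)]; linarith [n.cast_nonneg (α := ℝ)]
  linarith [Real.pi_gt_three]

/-- Equality in both lower bounds: the marginals are Gaussian, and the plan lives on the graph where
the duality gap is zero. -/
theorem uotCost_gaussianPlan {γ : ℝ} (hγ : 0 < γ) {α β : Ref d} (hα : α.Nondegenerate)
    (hβ : β.Nondegenerate) {c : ℝ} (hc : 0 < c) {q : Moments d} (hq : q ∈ momentDomain d) :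
    uotCost γ α β (gaussianPlan c q) ≠ ⊤ ∧
      (uotCost γ α β (gaussianPlan c q)).toReal = finObjective γ α β (c, q) := by
  have hplan := rotatedPlan_mem_plans 0 c hq
  have hfst := rotatedPlan_fst 0 c q
  have hsnd := rotatedPlan_snd 0 c hq
  rw [rotatedPlan_zero] at hplan hfst hsnd
  obtain ⟨hkα, hα'⟩ := klDiv_gaussian hα hc q.1 hq.1
  obtain ⟨hkβ, hβ'⟩ := klDiv_gaussian hβ hc q.2.2.1 hq.2
  have hcost : ∫ x, ‖x.2 - x.1‖ ^ 2 ∂(gaussianPlan c q) = c * gelbrich q := by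
    rw [← integral_dualPotential hq (hfst ▸ hasMoments_gaussian hc q.1 hq.1.posSemidef)
      (hsnd ▸ hasMoments_gaussian hc q.2.2.1 hq.2.posSemidef)]
    have hTc := continuous_toEuclideanLin (transportMatrix q.2.1 q.2.2.2)
    have hm : Measurable fun x => (x, transportMap q x) := by
      unfold transportMap
      exact (by fun_prop : Continuous _).measurable
    refine integral_congr_ae ?_
    have hs : MeasurableSet {x : Vec d × Vec d | x.2 = transportMap q x.1} := by
      unfold transportMap
      exact (isClosed_eq (by fun_prop) (by fun_prop)).measurableSet
    have hae : ∀ᵐ x ∂(gaussianPlan c q), x.2 = transportMap q x.1 :=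
      (ae_map_iff hm.aemeasurable hs).2 (Filter.Eventually.of_forall fun _ => rfl)
    filter_upwards [hae] with x hx
    rw [norm_sub_sq_eq_dualPotential_add hq, hx, transportMap, map_sub]
    have hz : ∀ a b e : Vec d, a + (b - e) - b - (a - e) = 0 := fun a b e => by abel
    rw [hz]
    simp [quad]
  have h₁ : ENNReal.ofReal γ * klDiv (gaussian c q.1 q.2.1) α.measure ≠ ⊤ :=
    ENNReal.mul_ne_top ENNReal.ofReal_ne_top hkα
  have h₂ : ENNReal.ofReal γ * klDiv (gaussian c q.2.2.1 q.2.2.2) β.measure ≠ ⊤ :=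
    ENNReal.mul_ne_top ENNReal.ofReal_ne_top hkβ
  have hpos : 0 ≤ c * gelbrich q := hcost ▸ integral_nonneg fun _ => by positivity
  rw [uotCost, lintegral_norm_sub_sq hplan, hcost, hfst, hsnd]
  refine ⟨ENNReal.add_ne_top.2 ⟨ENNReal.add_ne_top.2 ⟨ENNReal.ofReal_ne_top, h₁⟩, h₂⟩, ?_⟩
  rw [ENNReal.toReal_add (ENNReal.add_ne_top.2 ⟨ENNReal.ofReal_ne_top, h₁⟩) h₂,
    ENNReal.toReal_add ENNReal.ofReal_ne_top h₁, ENNReal.toReal_mul, ENNReal.toReal_mul,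
    ENNReal.toReal_ofReal hγ.le, ENNReal.toReal_ofReal hpos, hα', hβ',
    finObjective_eq_gelbrich_add]

end GaussianUOT

/-! ### Global optimality of the algorithm -/

open GaussianUOT
theorem mainTheorem2 {d : ℕ} (hd : 0 < d) (γ : ℝ) (hγ : 0 < γ) (α β : Ref d)
    (hα : α.Nondegenerate) (hβ : β.Nondegenerate) :
    -- the subproblem is convex and the algorithm has an outcome
    ConvexOn ℝ (momentDomain d) (subObjective γ α β) ∧
    (∃ (q : Moments d) (p c : ℝ), IsOutput γ α β q p c) ∧
    -- every outcome of the algorithm is globally optimal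
    ∀ (q : Moments d) (p c : ℝ), IsOutput γ α β q p c →
      -- the Gaussian plan built from the outcome is admissible, with the computed marginals
      gaussianPlan c q ∈ plans d ∧
      (gaussianPlan c q).fst = gaussian c q.1 q.2.1 ∧
      (gaussianPlan c q).snd = gaussian c q.2.2.1 q.2.2.2 ∧
      -- it minimizes the cost over all plans, and its value is the infimum over plans with a density
      (∀ π ∈ plans d, uotCost γ α β (gaussianPlan c q) ≤ uotCost γ α β π) ∧
      IsGLB (uotCost γ α β '' acPlans d) (uotCost γ α β (gaussianPlan c q)) ∧
      -- the optimal value is finite and equals `c p + ψ(c)`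
      uotCost γ α β (gaussianPlan c q) ≠ ⊤ ∧
      (uotCost γ α β (gaussianPlan c q)).toReal = c * p + psi γ α β c ∧
      -- the outcome solves the finite-dimensional problem, with the same value
      (c, q) ∈ finDomain d ∧
      finObjective γ α β (c, q) = c * p + psi γ α β c ∧
      IsLeast (finObjective γ α β '' finDomain d) (c * p + psi γ α β c) ∧
      -- the mass problem is convex and the computed mass is its unique minimizer
      ConvexOn ℝ (Set.Ioi 0) (fun x : ℝ => x * p + psi γ α β x) ∧
      (∀ x : ℝ, 0 < x → x ≠ c → c * p + psi γ α β c < x * p + psi γ α β x) := by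
  refine ⟨convexOn_subObjective hγ hα hβ, exists_isOutput hγ hα hβ, fun q p c h => ?_⟩
  have hc := h.mass_pos hα hβ
  have hfst := rotatedPlan_fst 0 c q
  have hsnd := rotatedPlan_snd 0 c h.mem
  have hplan := rotatedPlan_mem_plans 0 c h.mem
  rw [rotatedPlan_zero] at hfst hsnd hplan
  obtain ⟨htop, hval⟩ := uotCost_gaussianPlan hγ hα hβ hc h.mem
  have hfin : finObjective γ α β (c, q) = c * p + psi γ α β c := by
    rw [finObjective_eq, h.value]
  rw [hfin] at hval
  have hmin : ∀ π ∈ plans d, uotCost γ α β (gaussianPlan c q) ≤ uotCost γ α β π :=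
    fun π hπ => by
      rw [← ENNReal.ofReal_toReal htop, hval]
      exact h.le_uotCost hγ hα hβ hπ
  exact ⟨hplan, hfst, hsnd, hmin, isGLB_uotCost_acPlans h.mem hmin, htop, hval, ⟨hc, h.mem⟩, hfin,
    ⟨⟨(c, q), ⟨hc, h.mem⟩, hfin⟩, Set.forall_mem_image.2 fun z hz => h.le_finObjective hγ hα hβ hz⟩,
    h.convexOn_massObjective hγ hα hβ, fun x hx hxc => h.massObjective_lt hγ hα hβ hx hxc⟩
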